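/- Let $\mathcal I$ be a finite set of preceding vehicles, $1\in\mathcal I$ the vehicle immediately ahead of the truck. Let $\alpha,\kappa,\beta_i\in\mathbb R$ and let $\sigma\ge 0$, $\sigma_i\ge 0$ ($i\in\mathcal I$) be delays. The linearized closed-loop dynamics of the truck around the equilibrium with speed $v^*$ are $$\dot{\tilde h}(t)=\tilde v_1(t)-\tilde v(t),\qquad \dot{\tilde v}(t)=\alpha\big(\kappa\tilde h(t-\sigma)-\tilde v(t-\sigma)\big)+\sum_{i\in\mathcal I}\beta_i\big(\tilde v_i(t-(\sigma+\sigma_i))-\tilde v(t-\sigma)\big),$$ where $\tilde h$ and $\tilde v=v-v^*$ are the perturbations of the truck's headway and speed and $\tilde v_i$ are the speed perturbations of the preceding vehicles. Put $$\mathcal D(s)=s^2e^{s\sigma}+\Big(\alpha+\sum_{i\in\mathcal I}\beta_i\Big)s+\alpha\kappa,\qquad T_1(s)=\frac{\beta_1 s e^{-s\sigma_1}+\alpha\kappa}{\mathcal D(s)},\qquad T_i(s)=\frac{\beta_i s e^{-s\sigma_i}}{\mathcal D(s)}\quad(i\ne 1),$$ and assume plant stability: every root $s\in\mathbb C$ of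 $\mathcal D(s)=0$ satisfies $\operatorname{Re}s<0$. Let $(\tilde v_i(t))_{t\in\mathbb R}$, $i\in\mathcal I$, be jointly Gaussian, jointly wide-sense stationary, mean-square differentiable processes with zero mean, whose correlation functions $R_{\tilde v_i\tilde v_j}(\tau)=\mathbb E[\tilde v_i(t+\tau)\tilde v_j(t)]$ are integrable over $\tau\in\mathbb R$, and let $S_{\tilde v_i\tilde v_j}(\omega)=\int_{-\infty}^{\infty}R_{\tilde v_i\tilde v_j}(\tau)e^{-\mathrm j\omega\tau}\,\mathrm d\tau$ be their (cross) power spectral densities. Let $(\tilde h,\tilde v)$ be a steady-state response of the truck, that is, a solution of the linearized dynamics for all $t\in\mathbb R$, with derivatives in the mean-square sense, whose second moments are bounded uniformly in $t$. Let $v=v^*+\tilde v$, and let $\dot v$ be its mean-square derivative, where $v$ and $\dot v$ are jointly measurable in time and chance. Then all the integrals below converge and there is $\vartheta\ge 0$ with $$\vartheta^2=\frac1\pi\sum_{i,j\in\mathcal I}\int_0^\infty\omega^2\,T_i(\mathrm j\omega)\,T_j^*(\mathrm j\omega)\,S_{\tilde v_i\tilde v_j}(\omega)\,\mathrm d\omega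 .$$ For every $t$, $\vartheta^2$ is the variance of $\dot v(t)$, and also that of $\dot{\tilde v}(t)$. Moreover, for all $t_0\le t_{\mathrm f}$ the surrogate energy $\bar w=\int_{t_0}^{t_{\mathrm f}}v(t)\max\{\dot v(t),0\}\,\mathrm dt$ is almost surely well defined, is integrable, and satisfies $$\mathbb E[\bar w]=(t_{\mathrm f}-t_0)\,\frac{v^*}{\sqrt{2\pi}}\,\vartheta .$$ -/

import Mathlib

open MeasureTheory ProbabilityTheory Filter Topology

noncomputable section

namespace Truck

/-! ### Second-order stochastic processes in continuous time -/

section Processes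

variable {Ω : Type*} [MeasurableSpace Ω] (P : Measure Ω)

/-- The correlation `E[X_s Y_t]` of two real stochastic processes. -/
def correlation (X Y : ℝ → Ω → ℝ) (s t : ℝ) : ℝ :=
  ∫ ω, X s ω * Y t ω ∂P

/-- The family of processes `X i` is (jointly) wide-sense stationary: all variables are square
integrable, all means are constant in time, and all auto- and cross-correlations `E[X_i(s) X_j(t)]`
depend only on the lag `s - t`. -/
structure IsWSS {ι : Type*} (X : ι → ℝ → Ω → ℝ) : Prop where
  memLp : ∀ i t, MemLp (X i t) 2 P
  mean : ∀ i, ∃ m : ℝ, ∀ t, ∫ ω, X i t ω ∂P = m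
  correlation : ∀ i j, ∃ r : ℝ → ℝ, ∀ s t, correlation P (X i) (X j) s t = r (s - t)

/-- `X'` is the mean-square derivative of the process `X`: for every `t`,
`(X (t + h) - X t) / h → X' t` in `L²` as `h → 0`, `h ≠ 0`. -/
def IsMSDeriv (X X' : ℝ → Ω → ℝ) : Prop :=
  ∀ t, MemLp (X' t) 2 P ∧
    Tendsto (fun h : ℝ => eLpNorm (fun ω => (X (t + h) ω - X t ω) / h - X' t ω) 2 P)
      (𝓝[≠] 0) (𝓝 0)

/-- The process `X` is mean-square differentiable. -/
def IsMSDifferentiable (X : ℝ → Ω → ℝ) : Prop :=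
  ∃ X' : ℝ → Ω → ℝ, IsMSDeriv P X X'

/-- The process `X` has second moments that are finite and bounded uniformly in time. -/
def HasBoundedSecondMoments (X : ℝ → Ω → ℝ) : Prop :=
  (∀ t, MemLp (X t) 2 P) ∧ ∃ C : ℝ, ∀ t, ∫ ω, X t ω ^ 2 ∂P ≤ C

/-- The cross-correlation function `R_{XY}(τ) = E[X_{t+τ} Y_t]` of jointly wide-sense stationary
processes, evaluated at `t = 0` (it does not depend on `t`). -/
def crossCorrelation (X Y : ℝ → Ω → ℝ) (τ : ℝ) : ℝ :=
  correlation P X Y τ 0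

/-- The cross power spectral density `S_{XY}(w) = ∫ R_{XY}(τ) e^{-j w τ} dτ`; the power spectral
density when `X = Y`. -/
def crossSpectralDensity (X Y : ℝ → Ω → ℝ) (w : ℝ) : ℂ :=
  ∫ τ : ℝ, (crossCorrelation P X Y τ : ℂ) * Complex.exp (-(Complex.I * w * τ))

/-- The speed perturbations of the preceding vehicles are jointly wide-sense stationary,
mean-square differentiable, jointly Gaussian processes with zero mean. -/
structure IsStationaryGaussianInput {ι : Type*} (X : ι → ℝ → Ω → ℝ) : Prop where
  wss : IsWSS P X
  msDifferentiable : ∀ i, IsMSDifferentiable P (X i)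
  gaussian : IsGaussianProcess (fun (p : ι × ℝ) (ω : Ω) => X p.1 p.2 ω) P
  mean_zero : ∀ i t, ∫ ω, X i t ω ∂P = 0

/-- The surrogate energy consumption per unit mass `∫_{t₀}^{t_f} v(t) max(a(t), 0) dt`, for a
speed process `v` and an acceleration process `a`, along the sample path of `ω`. -/
def surrogateEnergy (v a : ℝ → Ω → ℝ) (t₀ tf : ℝ) (ω : Ω) : ℝ :=
  ∫ t in t₀..tf, v t ω * max (a t ω) 0

end Processes

/-! ### The linearized connected cruise control loop -/

/-- Parameters of the linearized closed loop. The index type `ι` is the set of preceding vehicles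
whose motion is known to the truck; `one` is the vehicle immediately ahead. -/
structure Params (ι : Type*) where
  /-- the vehicle immediately ahead of the truck -/
  one : ι
  /-- headway gain -/
  α : ℝ
  /-- gradient of the range policy at the equilibrium -/
  κ : ℝ
  /-- speed gains -/
  β : ι → ℝ
  /-- powertrain delay -/
  σ : ℝ
  /-- additional delays of the responses to the speeds of the preceding vehicles -/
  δ : ι → ℝ

namespace Params

variable {ι : Type*} [Fintype ι] (p : Params ι)

/-- The characteristic function `D(s) = s² e^{sσ} + (α + ∑ βᵢ) s + α κ`. -/
def charFun (s : ℂ) : ℂ :=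
  s ^ 2 * Complex.exp (s * p.σ) + (p.α + ∑ i, (p.β i : ℂ)) * s + p.α * p.κ

/-- Plant stability: all roots of `D(s) = 0` have negative real parts. -/
def PlantStable : Prop :=
  ∀ s : ℂ, p.charFun s = 0 → s.re < 0

open Classical in
/-- The link transfer functions: `(β₁ s e^{-sδ₁} + α κ) / D(s)` for the vehicle immediately ahead
(which is `(β₁ s + α κ) / D(s)` when that vehicle is responded to without additional delay,
`δ₁ = 0`), and `βᵢ s e^{-sδᵢ} / D(s)` for all other vehicles. -/
def transfer (i : ι) (s : ℂ) : ℂ :=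
  (p.β i * s * Complex.exp (-(s * p.δ i)) + if i = p.one then (p.α * p.κ : ℂ) else 0) / p.charFun s

/-- The right-hand side of the linearized speed equation,
`α (κ h̃(t-σ) - ṽ(t-σ)) + ∑ᵢ βᵢ (ṽᵢ(t-(σ+δᵢ)) - ṽ(t-σ))`. -/
def accel {Ω : Type*} (u : ι → ℝ → Ω → ℝ) (h v : ℝ → Ω → ℝ) (t : ℝ) (ω : Ω) : ℝ :=
  p.α * (p.κ * h (t - p.σ) ω - v (t - p.σ) ω)
    + ∑ i, p.β i * (u i (t - (p.σ + p.δ i)) ω - v (t - p.σ) ω)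

/-- The headway and speed perturbations `h`, `v` of the truck are a steady-state response of the
linearized dynamics to the speed perturbations `u i` of the preceding vehicles: they solve the
linearized delay differential equations, in mean square, on the whole time axis, and their second
moments stay bounded (so that no transient of an initial condition is present). -/
structure IsSteadyStateResponse {Ω : Type*} [MeasurableSpace Ω] (P : Measure Ω)
    (u : ι → ℝ → Ω → ℝ) (h v : ℝ → Ω → ℝ) : Prop where
  bounded_headway : HasBoundedSecondMoments P h
  bounded_speed : HasBoundedSecondMoments P v
  headway_eq : IsMSDeriv P h (fun t ω => u p.one t ω - v t ω)
  speed_eq : IsMSDeriv P v (p.accel u h v)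

/-- The term `w² Tᵢ(jw) Tⱼ*(jw) S_{uᵢuⱼ}(w)` of the spectral density of the acceleration. -/
def accelSpectrum {Ω : Type*} [MeasurableSpace Ω] (P : Measure Ω)
    (u : ι → ℝ → Ω → ℝ) (i j : ι) (w : ℝ) : ℂ :=
  (w : ℂ) ^ 2 * p.transfer i (Complex.I * w)
    * (starRingEnd ℂ) (p.transfer j (Complex.I * w)) * crossSpectralDensity P (u i) (u j) w

end Params

end Truck

end

noncomputable section

namespace Truck

/-! ### Bounded solutions of the homogeneous delay system -/

section BoundedSolutions

open scoped FourierTransform ContDiff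

/-! Everything takes place in the real Hilbert space `L²(P)`, where mean-square derivatives are
ordinary derivatives. The response is then a bounded curve on the whole line solving a linear delay
equation, and pairing it with a fixed vector `e` gives a bounded scalar solution of the same
equation.

Bounded scalar solutions are unique (`bounded_solution_eq_zero`, `Params.IsBoundedSolution.unique`):
the spectrum of a bounded homogeneous solution lies among the zeros of `D` on the imaginary axis,
and plant stability excludes these. Three choices of `e` exploit this. If `e` is orthogonal to all
inputs, the pairing vanishes, so the response lies in the closed span of the inputs
(`mem_closure_span`). If `e` is an input at time `s`, the scalar inputs are correlation functions,
which Fourier inversion writes as superpositions of harmonics, and the response multiplies each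
harmonic by `Tᵢ` (`inner_input`). If `e` is the speed at time `s`, the conjugate factor `Tⱼ*`
appears as well (`inner_self`). Differentiating the resulting speed correlation once in each time
variable produces the factor `w²` and the formula for `ϑ²` (`inner_hilbertAccel`).

Inversion needs integrable spectral densities, which are not assumed. Integrability comes from
positivity: the spectral matrix is positive semidefinite (`spectralDensity_form_nonneg`), a
nonnegative Fourier transform of a continuous integrable function is integrable
(`integrable_spectralDensity_of_nonneg`), and the diagonal entries dominate the others
(`norm_spectralDensity_le`).

The closed span of a centered Gaussian process consists of centered Gaussians
(`isCenteredGaussian_of_mem_closure`). The speed variance is constant in time, so speed perturbation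
and acceleration are orthogonal at each instant, hence independent (`indepFun_of_inner_eq_zero`).
Therefore `E[v max(a,0)] = v* E[max(a,0)] = v* ϑ / √(2π)`, and Fubini finishes. -/

theorem integrable_mul_of_bounded {x f : ℝ → ℂ} (hx : Continuous x) {C : ℝ}
    (hC : ∀ t, ‖x t‖ ≤ C) (hf : Integrable f) :
    Integrable (fun t => x t * f t) :=
  hf.bdd_mul hx.aestronglyMeasurable (Eventually.of_forall hC)

theorem integral_fun_sub_add {f g h : ℝ → ℂ} (hf : Integrable f) (hg : Integrable g)
    (hh : Integrable h) :
    (∫ t, f t) - (∫ t, g t) + ∫ t, h t = ∫ t, (f t - g t + h t) := by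
  rw [← integral_sub hf hg]
  exact (integral_add (hf.sub hg) hh).symm

/-- Integration by parts of a bounded function against an integrable one. -/
theorem integral_mul_deriv_of_bounded {x x' f f' : ℝ → ℂ} (hx : ∀ t, HasDerivAt x (x' t) t)
    (hf : ∀ t, HasDerivAt f (f' t) t) (hx' : Continuous x') {C C' : ℝ} (hC : ∀ t, ‖x t‖ ≤ C)
    (hC' : ∀ t, ‖x' t‖ ≤ C') (hfi : Integrable f) (hfi' : Integrable f') :
    ∫ t, x t * f' t = - ∫ t, x' t * f t := by
  have hxc : Continuous x := continuous_iff_continuousAt.2 fun t => (hx t).continuousAt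
  exact integral_mul_deriv_eq_deriv_mul_of_integrable (fun t _ => hx t) (fun t _ => hf t)
    (integrable_mul_of_bounded hxc hC hfi') (integrable_mul_of_bounded hx' hC' hfi)
    (integrable_mul_of_bounded hxc hC hfi)

/-- A bounded solution of the homogeneous delay system annihilates the image of the formal
adjoint. -/
theorem integral_mul_adjoint_eq_zero {σ : ℝ} {A B : ℂ} {x y : ℝ → ℂ}
    (hx : ∀ t, HasDerivAt x (-y t) t)
    (hy : ∀ t, HasDerivAt y (B * x (t - σ) - A * y (t - σ)) t)
    {C C' : ℝ} (hC : ∀ t, ‖x t‖ ≤ C) (hC' : ∀ t, ‖y t‖ ≤ C')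
    {f f' f'' : ℝ → ℂ} (hf : ∀ t, HasDerivAt f (f' t) t) (hf' : ∀ t, HasDerivAt f' (f'' t) t)
    (hfi : Integrable f) (hfi' : Integrable f') (hfi'' : Integrable f'') :
    ∫ t, x t * (f'' (t - σ) - A * f' t + B * f t) = 0 := by
  have hxc : Continuous x := continuous_iff_continuousAt.2 fun t => (hx t).continuousAt
  have hyc : Continuous y := continuous_iff_continuousAt.2 fun t => (hy t).continuousAt
  have h1 : ∫ t, x t * f' t = ∫ t, y t * f t := by
    rw [integral_mul_deriv_of_bounded hx hf hyc.neg hC (C' := C') (by simpa using hC') hfi hfi',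
      ← integral_neg]
    simp
  -- The test function is delayed by `σ` as well: after integrating by parts against `y`, the delay
  -- in the equation for `y` matches it, and translation invariance removes both.
  have hs : ∀ t, HasDerivAt (fun t => f (t - σ)) (f' (t - σ)) t := fun t =>
    (hf (t - σ)).comp_sub_const t σ
  have hs' : ∀ t, HasDerivAt (fun t => f' (t - σ)) (f'' (t - σ)) t := fun t =>
    (hf' (t - σ)).comp_sub_const t σ
  have h2 : ∫ t, x t * f'' (t - σ) = ∫ t, y t * f' (t - σ) := by
    rw [integral_mul_deriv_of_bounded hx hs' hyc.neg hC (C' := C') (by simpa using hC')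
      (hfi'.comp_sub_right σ) (hfi''.comp_sub_right σ), ← integral_neg]
    simp
  have h3 : ∫ t, y t * f' (t - σ) = - ∫ t, (B * x t - A * y t) * f t := by
    rw [integral_mul_deriv_of_bounded hy hs (by fun_prop) hC' (C' := ‖B‖ * C + ‖A‖ * C') ?_
      (hfi.comp_sub_right σ) (hfi'.comp_sub_right σ)]
    · rw [integral_sub_right_eq_self (fun t => (B * x t - A * y t) * f t) σ]
    · intro t
      refine (norm_sub_le _ _).trans ?_
      rw [norm_mul, norm_mul]
      gcongr
      exacts [hC _, hC' _]
  have i1 := integrable_mul_of_bounded hxc hC hfi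
  have i2 := integrable_mul_of_bounded hxc hC hfi'
  have i3 := integrable_mul_of_bounded hxc hC (hfi''.comp_sub_right σ)
  have i4 := integrable_mul_of_bounded hyc hC' hfi
  have e1 : ∫ t, (B * x t - A * y t) * f t = B * (∫ t, x t * f t) - A * ∫ t, y t * f t := by
    rw [← integral_const_mul, ← integral_const_mul,
      ← integral_sub (i1.const_mul B) (i4.const_mul A)]
    exact integral_congr_ae (Eventually.of_forall fun t => by ring)
  have e2 : ∫ t, x t * (f'' (t - σ) - A * f' t + B * f t)
      = (∫ t, x t * f'' (t - σ)) - A * (∫ t, x t * f' t) + B * ∫ t, x t * f t := by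
    rw [← integral_const_mul, ← integral_const_mul,
      integral_fun_sub_add i3 (i2.const_mul A) (i1.const_mul B)]
    exact integral_congr_ae (Eventually.of_forall fun t => by ring)
  rw [e2, h2, h3, e1, h1]
  ring

theorem integrable_fourier_of_hasCompactSupport {g : ℝ → ℂ} (hg : ContDiff ℝ ∞ g)
    (hs : HasCompactSupport g) : Integrable (𝓕 g) :=
  (𝓕 (hs.toSchwartzMap hg)).integrable

theorem hasDerivAt_fourier_of_hasCompactSupport {g : ℝ → ℂ} (hg : ContDiff ℝ ∞ g)
    (hs : HasCompactSupport g) (t : ℝ) :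
    HasDerivAt (𝓕 g) (𝓕 (fun v : ℝ => (-(2 * Real.pi * Complex.I * v)) * g v) t) t := by
  have h := Real.hasDerivAt_fourier (f := g) (hg.continuous.integrable_of_hasCompactSupport hs)
    (Continuous.integrable_of_hasCompactSupport (by have := hg.continuous; fun_prop) hs.smul_left) t
  simpa [smul_eq_mul] using h

/-- A bounded solution of the homogeneous delay system annihilates the Fourier transforms of
smooth functions of compact support. -/
theorem integral_mul_fourier_eq_zero {σ : ℝ} {A B : ℂ}
    (hD : ∀ w : ℝ, (Complex.I * w) ^ 2 * Complex.exp (Complex.I * w * σ) + A * (Complex.I * w) + B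
      ≠ 0) {x y : ℝ → ℂ}
    (hx : ∀ t, HasDerivAt x (-y t) t)
    (hy : ∀ t, HasDerivAt y (B * x (t - σ) - A * y (t - σ)) t)
    {C C' : ℝ} (hC : ∀ t, ‖x t‖ ≤ C) (hC' : ∀ t, ‖y t‖ ≤ C')
    {g : ℝ → ℂ} (hg : ContDiff ℝ ∞ g) (hs : HasCompactSupport g) :
    ∫ t, x t * 𝓕 g t = 0 := by
  have hcd : ContDiff ℝ ∞ (fun v : ℝ => (v : ℂ)) := Complex.ofRealCLM.contDiff
  let D : ℝ → ℂ := fun v => (Complex.I * (2 * Real.pi * v : ℝ)) ^ 2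
    * Complex.exp (Complex.I * (2 * Real.pi * v : ℝ) * σ) + A * (Complex.I * (2 * Real.pi * v : ℝ))
    + B
  have hDs : ContDiff ℝ ∞ D := by
    have : ContDiff ℝ ∞ (fun v : ℝ => ((2 * Real.pi * v : ℝ) : ℂ)) :=
      hcd.comp (contDiff_const.mul contDiff_id)
    have h1 : ContDiff ℝ ∞ (fun v : ℝ => Complex.I * ((2 * Real.pi * v : ℝ) : ℂ)) :=
      contDiff_const.mul this
    exact (((h1.pow 2).mul (h1.mul contDiff_const).cexp).add (contDiff_const.mul h1)).add
      contDiff_const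
  -- The adjoint operator acts on `𝓕 k` as multiplication of `k` by `D`, since differentiating `𝓕`
  -- multiplies by `q` and delaying by `σ` multiplies by an exponential. Dividing by the zero-free
  -- `D` thus solves the adjoint equation with right-hand side `𝓕 g`.
  let k : ℝ → ℂ := fun v => (D v)⁻¹ * g v
  have hk : ContDiff ℝ ∞ k := (hDs.inv fun v => hD _).mul hg
  have hks : HasCompactSupport k := hs.mul_left
  let q : ℝ → ℂ := fun v => -(2 * Real.pi * Complex.I * v)
  have hq : ContDiff ℝ ∞ q := (contDiff_const.mul hcd).neg
  have hk1 : ContDiff ℝ ∞ (fun v => q v * k v) := hq.mul hk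
  have hk1s : HasCompactSupport (fun v => q v * k v) := hks.mul_left
  have hk2 : ContDiff ℝ ∞ (fun v => q v * (q v * k v)) := hq.mul hk1
  have hk2s : HasCompactSupport (fun v => q v * (q v * k v)) := hk1s.mul_left
  have key := integral_mul_adjoint_eq_zero hx hy hC hC'
    (hasDerivAt_fourier_of_hasCompactSupport hk hks)
    (hasDerivAt_fourier_of_hasCompactSupport hk1 hk1s)
    (integrable_fourier_of_hasCompactSupport hk hks)
    (integrable_fourier_of_hasCompactSupport hk1 hk1s)
    (integrable_fourier_of_hasCompactSupport hk2 hk2s)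
  rw [← key]
  refine integral_congr_ae (Eventually.of_forall fun t => ?_)
  dsimp only
  congr 1
  simp only [Real.fourier_real_eq_integral_exp_smul, smul_eq_mul]
  have ic : ∀ {f : ℝ → ℂ}, ContDiff ℝ ∞ f → HasCompactSupport f → ∀ t : ℝ,
      Integrable (fun v : ℝ => Complex.exp (↑(-2 * Real.pi * v * t) * Complex.I) * f v) := by
    intro f hf hfs t
    have := hf.continuous
    exact Continuous.integrable_of_hasCompactSupport (by fun_prop) hfs.mul_left
  rw [← integral_const_mul, ← integral_const_mul,
    integral_fun_sub_add (ic hk2 hk2s _) ((ic hk1 hk1s t).const_mul A) ((ic hk hks t).const_mul B)]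
  refine integral_congr_ae (Eventually.of_forall fun v => ?_)
  dsimp only
  have hDk : g v = D v * k v := by
    simp only [k]; rw [← mul_assoc, mul_inv_cancel₀ (hD _), one_mul]
  have he : Complex.exp (↑(-2 * Real.pi * v * (t - σ)) * Complex.I)
      = Complex.exp (↑(-2 * Real.pi * v * t) * Complex.I)
        * Complex.exp (Complex.I * (2 * Real.pi * v : ℝ) * σ) := by
    rw [← Complex.exp_add]; congr 1; push_cast; ring
  rw [hDk, he]
  simp only [D, q]
  push_cast
  ring

/-- Stretching a bump `g` with `g 0 = 1` compresses its Fourier transform into an approximate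
identity of mass one. All the integrals of `x` against these kernels vanish, and they converge to `x
0`. -/
theorem bounded_solution_apply_zero {σ : ℝ} {A B : ℂ}
    (hD : ∀ w : ℝ, (Complex.I * w) ^ 2 * Complex.exp (Complex.I * w * σ) + A * (Complex.I * w) + B
      ≠ 0) {x y : ℝ → ℂ}
    (hx : ∀ t, HasDerivAt x (-y t) t)
    (hy : ∀ t, HasDerivAt y (B * x (t - σ) - A * y (t - σ)) t)
    {C C' : ℝ} (hC : ∀ t, ‖x t‖ ≤ C) (hC' : ∀ t, ‖y t‖ ≤ C') : x 0 = 0 := by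
  have hxc : Continuous x := continuous_iff_continuousAt.2 fun t => (hx t).continuousAt
  let b : ContDiffBump (0 : ℝ) := ⟨1, 2, one_pos, one_lt_two⟩
  let g : ℝ → ℂ := fun v => (b v : ℂ)
  have hg : ContDiff ℝ ∞ g := Complex.ofRealCLM.contDiff.comp b.contDiff
  have hgs : HasCompactSupport g := b.hasCompactSupport.comp_left Complex.ofReal_zero
  have hFi := integrable_fourier_of_hasCompactSupport hg hgs
  have hF1 : ∫ t, 𝓕 g t = 1 := by
    have h := Continuous.fourierInv_fourier_eq hg.continuous
      (hg.continuous.integrable_of_hasCompactSupport hgs) hFi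
    have h0 := congrFun h 0
    rw [Real.fourierInv_eq] at h0
    simpa [g, b.one_of_mem_closedBall (x := 0) (by simp [b])] using h0
  have hz : ∀ n : ℕ, ∫ r, x (((n : ℝ) + 1)⁻¹ * r) * 𝓕 g r = 0 := by
    intro n
    have hn : (0 : ℝ) < (n : ℝ) + 1 := by positivity
    set c : ℝ := (n : ℝ) + 1
    have hgc : ContDiff ℝ ∞ (fun v => g (c⁻¹ * v)) := hg.comp (contDiff_const.mul contDiff_id)
    have hgcs : HasCompactSupport (fun v => g (c⁻¹ * v)) :=
      hgs.comp_homeomorph (Homeomorph.mulLeft₀ c⁻¹ (by positivity))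
    have h := integral_mul_fourier_eq_zero hD hx hy hC hC' hgc hgcs
    have hF : ∀ t, 𝓕 (fun v => g (c⁻¹ * v)) t = c * 𝓕 g (c * t) := by
      intro t
      simp only [Real.fourier_real_eq_integral_exp_smul, smul_eq_mul]
      have := Measure.integral_comp_mul_left
        (fun v : ℝ => Complex.exp (↑(-2 * Real.pi * v * (c * t)) * Complex.I) * g v) c⁻¹
      rw [inv_inv, abs_of_pos hn, Complex.real_smul] at this
      rw [← this]
      refine integral_congr_ae (Eventually.of_forall fun v => ?_)
      dsimp only
      congr 3
      field_simp
    have h2 := Measure.integral_comp_mul_left (fun r => x (c⁻¹ * r) * 𝓕 g r) c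
    rw [abs_of_pos (by positivity), Complex.real_smul] at h2
    have h3 : ∫ t, x t * 𝓕 (fun v => g (c⁻¹ * v)) t
        = c * ∫ t, x (c⁻¹ * (c * t)) * 𝓕 g (c * t) := by
      rw [← integral_const_mul]
      refine integral_congr_ae (Eventually.of_forall fun t => ?_)
      dsimp only
      rw [hF, inv_mul_cancel_left₀ hn.ne']
      ring
    rw [h3, h2, Complex.ofReal_inv, mul_inv_cancel_left₀ (by exact_mod_cast hn.ne')] at h
    exact h
  have hlim : Tendsto (fun n : ℕ => ∫ r, x (((n : ℝ) + 1)⁻¹ * r) * 𝓕 g r) atTop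
      (𝓝 (∫ r, x 0 * 𝓕 g r)) := by
    refine tendsto_integral_of_dominated_convergence (fun r => C * ‖𝓕 g r‖) ?_
      (hFi.norm.const_mul C) ?_ ?_
    · intro n
      exact (Continuous.aestronglyMeasurable (by fun_prop)).mul hFi.1
    · intro n
      refine Eventually.of_forall fun r => ?_
      rw [norm_mul]
      gcongr
      exact hC _
    · refine Eventually.of_forall fun r => ?_
      refine Tendsto.mul_const _ (hxc.continuousAt.tendsto.comp ?_)
      have h0 : Tendsto (fun n : ℕ => ((n : ℝ) + 1)⁻¹) atTop (𝓝 0) := by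
        simpa [one_div] using tendsto_one_div_add_atTop_nhds_zero_nat (𝕜 := ℝ)
      simpa using h0.mul_const r
  rw [integral_const_mul, hF1, mul_one] at hlim
  simp only [hz] at hlim
  exact tendsto_nhds_unique hlim tendsto_const_nhds |>.symm ▸ rfl

/-- The homogeneous delay system has no bounded solution on the whole time axis but zero if its
characteristic function has no zeros on the imaginary axis. -/
theorem bounded_solution_eq_zero {σ : ℝ} {A B : ℂ}
    (hD : ∀ w : ℝ, (Complex.I * w) ^ 2 * Complex.exp (Complex.I * w * σ) + A * (Complex.I * w) + B
      ≠ 0) {x y : ℝ → ℂ}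
    (hx : ∀ t, HasDerivAt x (-y t) t)
    (hy : ∀ t, HasDerivAt y (B * x (t - σ) - A * y (t - σ)) t)
    {C C' : ℝ} (hC : ∀ t, ‖x t‖ ≤ C) (hC' : ∀ t, ‖y t‖ ≤ C') (t : ℝ) : x t = 0 ∧ y t = 0 := by
  have hx0 : ∀ t, x t = 0 := by
    intro a
    have := bounded_solution_apply_zero hD (x := fun t => x (t + a)) (y := fun t => y (t + a))
      (fun t => (hx (t + a)).comp_add_const t a)
      (fun t => by
        have := (hy (t + a)).comp_add_const t a
        rwa [add_sub_right_comm] at this)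
      (fun t => hC _) (fun t => hC' _)
    simpa using this
  refine ⟨hx0 t, ?_⟩
  have h := hx t
  rw [show x = fun _ => 0 from funext hx0] at h
  simpa using h.unique (hasDerivAt_const t (0 : ℂ))

end BoundedSolutions

/-! ### Superposition of harmonic oscillations -/

/-- The superposition `∫ F(w) e^{jwt} dw` of harmonic oscillations. -/
def synthesis (F : ℝ → ℂ) (t : ℝ) : ℂ :=
  ∫ w : ℝ, F w * Complex.exp (Complex.I * w * t)

theorem norm_exp_I_mul (w t : ℝ) : ‖Complex.exp (Complex.I * w * t)‖ = 1 := by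
  rw [mul_assoc, ← Complex.ofReal_mul, mul_comm]
  exact Complex.norm_exp_ofReal_mul_I _

theorem norm_exp_neg_I_mul (w t : ℝ) : ‖Complex.exp (-(Complex.I * w * t))‖ = 1 := by
  rw [Complex.exp_neg, norm_inv, norm_exp_I_mul, inv_one]

theorem integrable_mul_exp {F : ℝ → ℂ} (hF : Integrable F) (t : ℝ) :
    Integrable (fun w : ℝ => F w * Complex.exp (Complex.I * w * t)) := by
  refine hF.mul_bdd (c := 1) (Continuous.aestronglyMeasurable (by fun_prop))
    (Eventually.of_forall fun w => ?_)
  rw [norm_exp_I_mul]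

theorem norm_synthesis_le (F : ℝ → ℂ) (t : ℝ) : ‖synthesis F t‖ ≤ ∫ w, ‖F w‖ := by
  refine (norm_integral_le_integral_norm _).trans_eq ?_
  simp only [norm_mul, norm_exp_I_mul, mul_one]

theorem synthesis_sub {F G : ℝ → ℂ} (hF : Integrable F) (hG : Integrable G) (t : ℝ) :
    synthesis (fun w => F w - G w) t = synthesis F t - synthesis G t := by
  simp only [synthesis, sub_mul]
  exact integral_sub (integrable_mul_exp hF t) (integrable_mul_exp hG t)

theorem synthesis_add {F G : ℝ → ℂ} (hF : Integrable F) (hG : Integrable G) (t : ℝ) :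
    synthesis (fun w => F w + G w) t = synthesis F t + synthesis G t := by
  simp only [synthesis, add_mul]
  exact integral_add (integrable_mul_exp hF t) (integrable_mul_exp hG t)

theorem synthesis_const_mul (c : ℂ) (F : ℝ → ℂ) (t : ℝ) :
    synthesis (fun w => c * F w) t = c * synthesis F t := by
  simp only [synthesis, mul_assoc]
  exact integral_const_mul c _

theorem synthesis_sum {ι : Type*} [Fintype ι] {F : ι → ℝ → ℂ} (hF : ∀ i, Integrable (F i))
    (t : ℝ) : synthesis (fun w => ∑ i, F i w) t = ∑ i, synthesis (F i) t := by
  simp only [synthesis, Finset.sum_mul]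
  exact integral_finsetSum _ fun i _ => integrable_mul_exp (hF i) t

theorem synthesis_shift (F : ℝ → ℂ) (c t : ℝ) :
    synthesis (fun w => F w * Complex.exp (-(Complex.I * w * c))) t = synthesis F (t - c) := by
  refine integral_congr_ae (Eventually.of_forall fun w => ?_)
  dsimp only
  rw [mul_assoc, ← Complex.exp_add]
  congr 2
  push_cast
  ring

theorem hasDerivAt_synthesis {F : ℝ → ℂ} (hF : Integrable F)
    (hF' : Integrable (fun w : ℝ => Complex.I * w * F w)) (t : ℝ) :
    HasDerivAt (synthesis F) (synthesis (fun w => Complex.I * w * F w) t) t := by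
  refine (hasDerivAt_integral_of_dominated_loc_of_deriv_le (s := Set.univ)
    (F := fun (t : ℝ) (w : ℝ) => F w * Complex.exp (Complex.I * w * t))
    (F' := fun (t : ℝ) (w : ℝ) => Complex.I * w * F w * Complex.exp (Complex.I * w * t))
    (bound := fun w => ‖Complex.I * w * F w‖)
    univ_mem (Eventually.of_forall fun s => (integrable_mul_exp hF s).1) (integrable_mul_exp hF t)
    (integrable_mul_exp hF' t).1 ?_ hF'.norm ?_).2
  · refine Eventually.of_forall fun w s _ => ?_
    rw [norm_mul _ (Complex.exp _), norm_exp_I_mul, mul_one]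
  · refine Eventually.of_forall fun w s _ => ?_
    have h1 : HasDerivAt (fun s : ℝ => Complex.I * w * (s : ℂ)) (Complex.I * w * 1) s :=
      (Complex.ofRealCLM.hasDerivAt (x := s)).const_mul _
    have := h1.cexp.const_mul (F w)
    exact this.congr_deriv (by ring)

/-! ### The frequency response of the truck -/

namespace Params

variable {ι : Type*} [Fintype ι] (p : Params ι)

open Classical in
/-- The transfer functions from the speeds of the preceding vehicles to the headway. -/
def headwayTransfer (i : ι) (s : ℂ) : ℂ :=
  ((if i = p.one then s * Complex.exp (s * p.σ) + (p.α + ∑ i, (p.β i : ℂ)) else 0)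
    - p.β i * Complex.exp (-(s * p.δ i))) / p.charFun s

variable {p}

theorem PlantStable.charFun_ne_zero (h : p.PlantStable) (w : ℝ) :
    p.charFun (Complex.I * w) ≠ 0 := fun h0 => by simpa using h _ h0

/-- This identity and `speed_relation` say that `e^{st}` in input channel `i` is answered by the
multiples `headwayTransfer i s` and `transfer i s` of `e^{st}`. -/
theorem headway_relation {s : ℂ} (hs : p.charFun s ≠ 0) [DecidableEq ι] (i : ι) :
    s * p.headwayTransfer i s = (if i = p.one then 1 else 0) - p.transfer i s := by
  unfold headwayTransfer transfer
  rw [mul_div_assoc', eq_sub_iff_add_eq, ← add_div, div_eq_iff hs]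
  split_ifs <;> simp only [charFun] <;> ring

theorem speed_relation {s : ℂ} (hs : p.charFun s ≠ 0) (i : ι) :
    s * p.transfer i s = Complex.exp (-(s * p.σ)) * (p.α * p.κ * p.headwayTransfer i s
      - (p.α + ∑ i, (p.β i : ℂ)) * p.transfer i s + p.β i * Complex.exp (-(s * p.δ i))) := by
  have he : Complex.exp (s * p.σ) * Complex.exp (-(s * p.σ)) = 1 := by
    rw [← Complex.exp_add, add_neg_cancel, Complex.exp_zero]
  have hE := Complex.exp_ne_zero (s * p.σ)
  rw [Complex.exp_neg, ← div_eq_inv_mul, eq_div_iff hE]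
  unfold headwayTransfer transfer
  rw [← sub_eq_zero]
  field_simp
  split_ifs <;> simp only [charFun] <;> ring

/-! ### Continuity and decay of the transfer functions on the imaginary axis -/

theorem continuous_charFun (p : Params ι) : Continuous fun w : ℝ => p.charFun (Complex.I * w) := by
  unfold charFun; fun_prop

theorem PlantStable.continuous_transfer (h : p.PlantStable) (i : ι) :
    Continuous fun w : ℝ => p.transfer i (Complex.I * w) := by
  unfold transfer
  exact Continuous.div (by fun_prop) (continuous_charFun p) h.charFun_ne_zero

theorem PlantStable.continuous_headwayTransfer (h : p.PlantStable) (i : ι) :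
    Continuous fun w : ℝ => p.headwayTransfer i (Complex.I * w) := by
  unfold headwayTransfer
  refine Continuous.div (Continuous.sub ?_ (by fun_prop)) (continuous_charFun p) h.charFun_ne_zero
  split_ifs <;> fun_prop

/-- The quadratic term has modulus `w²` and dominates for large `|w|`; on the remaining compact
interval `D` is continuous without zeros. -/
theorem PlantStable.exists_le_norm_charFun (h : p.PlantStable) :
    ∃ K : ℝ, 0 ≤ K ∧ ∀ w : ℝ, 1 + w ^ 2 ≤ K * ‖p.charFun (Complex.I * w)‖ := by
  set a : ℝ := ‖(p.α + ∑ i, (p.β i : ℂ))‖ with ha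
  set b : ℝ := ‖(p.α * p.κ : ℂ)‖ with hb
  -- For `|w| ≥ M ≥ 1` this gives `w² ≥ 2a|w| + 2b + 1`, which is exactly `1 + w² ≤ 2(w² - a|w| -
  -- b)`.
  set M : ℝ := 2 * a + 2 * b + 1
  have ha0 : 0 ≤ a := norm_nonneg _
  have hb0 : 0 ≤ b := norm_nonneg _
  obtain ⟨L, hL⟩ := (isCompact_Icc (a := -M) (b := M)).exists_bound_of_continuousOn
    (f := fun w : ℝ => ((1 + w ^ 2 : ℝ) : ℂ) / p.charFun (Complex.I * w))
    (Continuous.continuousOn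
      (Continuous.div (by fun_prop) (continuous_charFun p) h.charFun_ne_zero))
  refine ⟨max 2 L, by positivity, fun w => ?_⟩
  by_cases hw : w ∈ Set.Icc (-M) M
  · have h1 := hL w hw
    have hpos := norm_pos_iff.2 (h.charFun_ne_zero w)
    rw [norm_div, Complex.norm_real, Real.norm_of_nonneg (by positivity), div_le_iff₀ hpos] at h1
    exact h1.trans (by gcongr; exact le_max_right _ _)
  · have hw' : M ≤ |w| := by
      by_contra! hlt
      exact hw (abs_le.1 hlt.le)
    have h1 : |w| ^ 2 - a * |w| - b ≤ ‖p.charFun (Complex.I * w)‖ := by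
      have e1 : ‖(Complex.I * w) ^ 2 * Complex.exp (Complex.I * w * p.σ)‖ = |w| ^ 2 := by
        rw [norm_mul, norm_exp_I_mul]; simp
      have e2 : ‖(p.α + ∑ i, (p.β i : ℂ)) * (Complex.I * w)‖ = a * |w| := by
        rw [norm_mul, ← ha]; simp
      have t1 := norm_sub_norm_le ((Complex.I * w) ^ 2 * Complex.exp (Complex.I * w * p.σ))
        (-((p.α + ∑ i, (p.β i : ℂ)) * (Complex.I * w) + p.α * p.κ))
      have t2 := norm_add_le ((p.α + ∑ i, (p.β i : ℂ)) * (Complex.I * w)) (p.α * p.κ)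
      rw [norm_neg, sub_neg_eq_add, e1] at t1
      rw [e2] at t2
      have : p.charFun (Complex.I * w) = (Complex.I * w) ^ 2 * Complex.exp (Complex.I * w * p.σ)
          + ((p.α + ∑ i, (p.β i : ℂ)) * (Complex.I * w) + p.α * p.κ) := by
        unfold charFun; ring
      rw [this]
      linarith
    have h2 : 1 ≤ |w| := le_trans (by simp only [M]; linarith) hw'
    have h3 : 1 + w ^ 2 ≤ 2 * ‖p.charFun (Complex.I * w)‖ := by
      rw [← sq_abs w]
      nlinarith [mul_le_mul_of_nonneg_right hw' (abs_nonneg w), mul_le_mul_of_nonneg_left h2 hb0]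
    exact h3.trans (by gcongr; exact le_max_left _ _)

/-- A numerator of linear growth over a denominator of quadratic growth leaves decay of order one.
Hence a transfer function stays bounded after multiplication by `w`, which is what differentiation
under the integral sign requires. -/
theorem PlantStable.exists_div_charFun_le (h : p.PlantStable) {f : ℝ → ℂ} {c : ℝ}
    (hf : ∀ w, ‖f w‖ ≤ c * (1 + |w|)) :
    ∃ K : ℝ, ∀ w : ℝ, (1 + |w|) * ‖f w / p.charFun (Complex.I * w)‖ ≤ K := by
  obtain ⟨K, hK0, hK⟩ := h.exists_le_norm_charFun
  have hc : 0 ≤ c := by simpa using (norm_nonneg _).trans (hf 0)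
  refine ⟨2 * c * K, fun w => ?_⟩
  have hpos := norm_pos_iff.2 (h.charFun_ne_zero w)
  rw [norm_div, mul_div_assoc', div_le_iff₀ hpos]
  calc (1 + |w|) * ‖f w‖ ≤ (1 + |w|) * (c * (1 + |w|)) := by gcongr; exact hf w
    _ = c * (1 + |w|) ^ 2 := by ring
    _ ≤ c * (2 * (1 + w ^ 2)) := by
        gcongr; rw [← sq_abs w]; nlinarith [sq_nonneg (1 - |w|)]
    _ ≤ c * (2 * (K * ‖p.charFun (Complex.I * w)‖)) := by gcongr; exact hK w
    _ = _ := by ring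

theorem PlantStable.exists_transfer_le (h : p.PlantStable) (i : ι) :
    ∃ K : ℝ, ∀ w : ℝ, (1 + |w|) * ‖p.transfer i (Complex.I * w)‖ ≤ K := by
  refine h.exists_div_charFun_le (c := |p.β i| + ‖(p.α * p.κ : ℂ)‖) fun w => ?_
  refine (norm_add_le _ _).trans ?_
  have h1 : ‖p.β i * (Complex.I * w) * Complex.exp (-(Complex.I * w * p.δ i))‖ = |p.β i| * |w| := by
    rw [norm_mul, norm_exp_neg_I_mul]; simp
  have h2 : ∀ q : Prop, [Decidable q] → ‖(if q then (p.α * p.κ : ℂ) else 0)‖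
      ≤ ‖(p.α * p.κ : ℂ)‖ := by
    intro q _; split_ifs <;> simp [mul_nonneg]
  rw [h1]
  classical
  nlinarith [abs_nonneg (p.β i), norm_nonneg (p.α * p.κ : ℂ), abs_nonneg w,
    mul_nonneg (norm_nonneg (p.α * p.κ : ℂ)) (abs_nonneg w), h2 (i = p.one)]

theorem PlantStable.exists_headwayTransfer_le (h : p.PlantStable) (i : ι) :
    ∃ K : ℝ, ∀ w : ℝ, (1 + |w|) * ‖p.headwayTransfer i (Complex.I * w)‖ ≤ K := by
  set a : ℝ := ‖(p.α + ∑ i, (p.β i : ℂ))‖ with ha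
  have ha0 : 0 ≤ a := norm_nonneg _
  refine h.exists_div_charFun_le (c := 1 + a + |p.β i|) fun w => ?_
  refine (norm_sub_le _ _).trans ?_
  have h1 : ‖p.β i * Complex.exp (-(Complex.I * w * p.δ i))‖ = |p.β i| := by
    rw [norm_mul, norm_exp_neg_I_mul]; simp
  have h2 : ∀ q : Prop, [Decidable q] →
      ‖(if q then (Complex.I * w) * Complex.exp (Complex.I * w * p.σ) +
        (p.α + ∑ i, (p.β i : ℂ)) else 0)‖ ≤ |w| + a := by
    intro q _
    split_ifs
    · refine (norm_add_le _ _).trans ?_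
      rw [norm_mul, norm_exp_I_mul]; simp [ha]
    · simp; positivity
  rw [h1]
  classical
  nlinarith [abs_nonneg (p.β i), abs_nonneg w, mul_nonneg ha0 (abs_nonneg w),
    mul_nonneg (abs_nonneg (p.β i)) (abs_nonneg w), h2 (i = p.one)]

theorem norm_le_of_weighted {f : ℝ → ℂ} {K : ℝ} (h : ∀ w, (1 + |w|) * ‖f w‖ ≤ K) (w : ℝ) :
    ‖f w‖ ≤ K ∧ ‖Complex.I * w * f w‖ ≤ K := by
  have h1 := h w
  have h2 : ‖Complex.I * w * f w‖ = |w| * ‖f w‖ := by simp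
  constructor <;> nlinarith [norm_nonneg (f w), mul_nonneg (abs_nonneg w) (norm_nonneg (f w))]

theorem integrable_transfer_mul (h : p.PlantStable) (i : ι) {F : ℝ → ℂ} (hF : Integrable F) :
    Integrable (fun w : ℝ => p.transfer i (Complex.I * w) * F w) := by
  obtain ⟨K, hK⟩ := h.exists_transfer_le i
  exact hF.bdd_mul (c := K) (h.continuous_transfer i).aestronglyMeasurable
    (Eventually.of_forall fun w => (norm_le_of_weighted hK w).1)

theorem integrable_freq_transfer_mul (h : p.PlantStable) (i : ι) {F : ℝ → ℂ} (hF : Integrable F) :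
    Integrable (fun w : ℝ => Complex.I * w * p.transfer i (Complex.I * w) * F w) := by
  obtain ⟨K, hK⟩ := h.exists_transfer_le i
  have := h.continuous_transfer i
  exact hF.bdd_mul (c := K) (Continuous.aestronglyMeasurable (by fun_prop))
    (Eventually.of_forall fun w => (norm_le_of_weighted hK w).2)

theorem integrable_headwayTransfer_mul (h : p.PlantStable) (i : ι) {F : ℝ → ℂ}
    (hF : Integrable F) : Integrable (fun w : ℝ => p.headwayTransfer i (Complex.I * w) * F w) := by
  obtain ⟨K, hK⟩ := h.exists_headwayTransfer_le i
  exact hF.bdd_mul (c := K) (h.continuous_headwayTransfer i).aestronglyMeasurable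
    (Eventually.of_forall fun w => (norm_le_of_weighted hK w).1)

theorem integrable_freq_headwayTransfer_mul (h : p.PlantStable) (i : ι) {F : ℝ → ℂ}
    (hF : Integrable F) :
    Integrable (fun w : ℝ => Complex.I * w * p.headwayTransfer i (Complex.I * w) * F w) := by
  obtain ⟨K, hK⟩ := h.exists_headwayTransfer_le i
  have := h.continuous_headwayTransfer i
  exact hF.bdd_mul (c := K) (Continuous.aestronglyMeasurable (by fun_prop))
    (Eventually.of_forall fun w => (norm_le_of_weighted hK w).2)

/-! ### Bounded responses to deterministic inputs -/

/-- Bounded solutions of the linearized equations of motion with deterministic inputs `U i`. -/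
structure IsBoundedSolution (p : Params ι) (U : ι → ℝ → ℂ) (x y : ℝ → ℂ) : Prop where
  bounded_left : ∃ C : ℝ, ∀ t, ‖x t‖ ≤ C
  bounded_right : ∃ C : ℝ, ∀ t, ‖y t‖ ≤ C
  hasDerivAt_left : ∀ t, HasDerivAt x (U p.one t - y t) t
  hasDerivAt_right : ∀ t, HasDerivAt y (p.α * (p.κ * x (t - p.σ) - y (t - p.σ))
    + ∑ i, p.β i * (U i (t - (p.σ + p.δ i)) - y (t - p.σ))) t

/-- The inputs cancel in the difference of two solutions, leaving the homogeneous system with `A = α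
+ ∑ βᵢ` and `B = α κ`. -/
theorem IsBoundedSolution.unique (h : p.PlantStable) {U : ι → ℝ → ℂ} {x y x' y' : ℝ → ℂ}
    (hs : p.IsBoundedSolution U x y) (hs' : p.IsBoundedSolution U x' y') (t : ℝ) :
    x t = x' t ∧ y t = y' t := by
  obtain ⟨C₁, h₁⟩ := hs.bounded_left
  obtain ⟨C₂, h₂⟩ := hs.bounded_right
  obtain ⟨C₃, h₃⟩ := hs'.bounded_left
  obtain ⟨C₄, h₄⟩ := hs'.bounded_right
  have := bounded_solution_eq_zero (σ := p.σ) (A := p.α + ∑ i, (p.β i : ℂ)) (B := p.α * p.κ)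
    (x := fun t => x t - x' t) (y := fun t => y t - y' t) (C := C₁ + C₃) (C' := C₂ + C₄)
    (fun w => h.charFun_ne_zero w)
    (fun t => by
      exact ((hs.hasDerivAt_left t).sub (hs'.hasDerivAt_left t)).congr_deriv (by ring))
    (fun t => by
      refine ((hs.hasDerivAt_right t).sub (hs'.hasDerivAt_right t)).congr_deriv ?_
      rw [add_sub_add_comm, ← Finset.sum_sub_distrib, add_mul, Finset.sum_mul, sub_add_eq_sub_sub,
        sub_eq_add_neg _ (∑ i, _ * _), ← Finset.sum_neg_distrib]
      congr 1
      · ring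
      · exact Finset.sum_congr rfl fun i _ => by ring)
    (fun t => (norm_sub_le _ _).trans (add_le_add (h₁ t) (h₃ t)))
    (fun t => (norm_sub_le _ _).trans (add_le_add (h₂ t) (h₄ t))) t
  exact ⟨sub_eq_zero.1 this.1, sub_eq_zero.1 this.2⟩

/-- The equations hold harmonic by harmonic by `headway_relation` and `speed_relation`; integrating
over `w` preserves them because every integrand stays integrable after multiplication by `w`. -/
theorem isBoundedSolution_synthesis (h : p.PlantStable) {F : ι → ℝ → ℂ}
    (hF : ∀ i, Integrable (F i)) :
    p.IsBoundedSolution (fun i => synthesis (F i))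
      (synthesis fun w => ∑ i, p.headwayTransfer i (Complex.I * w) * F i w)
      (synthesis fun w => ∑ i, p.transfer i (Complex.I * w) * F i w) where
  bounded_left := ⟨_, norm_synthesis_le _⟩
  bounded_right := ⟨_, norm_synthesis_le _⟩
  hasDerivAt_left t := by
    classical
    have hi := integrable_finsetSum Finset.univ fun i _ => integrable_headwayTransfer_mul h i (hF i)
    have hi' := integrable_finsetSum Finset.univ
      fun i _ => integrable_freq_headwayTransfer_mul h i (hF i)
    have hv := integrable_finsetSum Finset.univ fun i _ => integrable_transfer_mul h i (hF i)
    have e : ∀ w : ℝ, Complex.I * w * ∑ i, p.headwayTransfer i (Complex.I * w) * F i w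
        = F p.one w - ∑ i, p.transfer i (Complex.I * w) * F i w := by
      intro w
      have hr := fun i => headway_relation (h.charFun_ne_zero w) i
      simp_rw [Finset.mul_sum, ← mul_assoc, hr, sub_mul, Finset.sum_sub_distrib]
      simp
    have hd := hasDerivAt_synthesis hi (by
      simpa only [Finset.mul_sum, ← mul_assoc] using hi') t
    simp only [e] at hd
    rwa [synthesis_sub (hF _) hv] at hd
  hasDerivAt_right t := by
    have hi := integrable_finsetSum Finset.univ fun i _ => integrable_headwayTransfer_mul h i (hF i)
    have hv := integrable_finsetSum Finset.univ fun i _ => integrable_transfer_mul h i (hF i)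
    have hv' := integrable_finsetSum Finset.univ
      fun i _ => integrable_freq_transfer_mul h i (hF i)
    have hd := hasDerivAt_synthesis hv (by
      simpa only [Finset.mul_sum, ← mul_assoc] using hv') t
    convert hd using 1
    have hFs : ∀ i, synthesis (F i) (t - (p.σ + p.δ i))
        = synthesis (fun w => F i w * Complex.exp (-(Complex.I * w * p.δ i))) (t - p.σ) := by
      intro i; rw [synthesis_shift, sub_sub]
    have hFi : ∀ i, Integrable fun w : ℝ =>
        p.β i * (F i w * Complex.exp (-(Complex.I * w * p.δ i))) := by
      intro i
      refine Integrable.const_mul ?_ _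
      refine (hF i).mul_bdd (c := 1) (Continuous.aestronglyMeasurable (by fun_prop))
        (Eventually.of_forall fun w => ?_)
      rw [norm_exp_neg_I_mul]
    have e : (fun w : ℝ => Complex.I * w * ∑ i, p.transfer i (Complex.I * w) * F i w)
        = fun w : ℝ => (p.α * p.κ * (∑ i, p.headwayTransfer i (Complex.I * w) * F i w)
          - (p.α + ∑ i, (p.β i : ℂ)) * (∑ i, p.transfer i (Complex.I * w) * F i w)
          + ∑ i, p.β i * (F i w * Complex.exp (-(Complex.I * w * p.δ i))))
          * Complex.exp (-(Complex.I * w * p.σ)) := by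
      funext w
      rw [Finset.mul_sum, Finset.mul_sum, Finset.mul_sum, ← Finset.sum_sub_distrib,
        ← Finset.sum_add_distrib, Finset.sum_mul]
      refine Finset.sum_congr rfl fun i _ => ?_
      rw [← mul_assoc, speed_relation (h.charFun_ne_zero w)]
      ring
    rw [e, synthesis_shift, synthesis_add (by exact (hi.const_mul _).sub (hv.const_mul _))
      (integrable_finsetSum Finset.univ fun i _ => hFi i), synthesis_sum hFi,
      synthesis_sub (hi.const_mul _) (hv.const_mul _), synthesis_const_mul, synthesis_const_mul]
    simp only [synthesis_const_mul, hFs, mul_sub, Finset.sum_sub_distrib, add_mul, Finset.sum_mul]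
    ring

/-- The bounded response to harmonic superpositions is given by the transfer functions. -/
theorem IsBoundedSolution.eq_synthesis (h : p.PlantStable) {F : ι → ℝ → ℂ}
    (hF : ∀ i, Integrable (F i)) {U : ι → ℝ → ℂ} (hU : ∀ i t, U i t = synthesis (F i) t)
    {x y : ℝ → ℂ} (hs : p.IsBoundedSolution U x y) (t : ℝ) :
    y t = synthesis (fun w => ∑ i, p.transfer i (Complex.I * w) * F i w) t := by
  obtain rfl : U = fun i => synthesis (F i) := by
    funext i t; exact hU i t
  exact (hs.unique h (isBoundedSolution_synthesis h hF) t).2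

end Params

/-! ### Positivity and integrability of spectral densities -/

section PositiveDefinite

open scoped RealInnerProductSpace

variable {E : Type*} [NormedAddCommGroup E] [InnerProductSpace ℝ E] [CompleteSpace E]

/-- The double integral is the squared norm of `∫ x`. -/
theorem integral_integral_inner_nonneg {x : ℝ → E} (hx : Continuous x) (A : ℝ) :
    0 ≤ ∫ s in (0 : ℝ)..A, ∫ t in (0 : ℝ)..A, ⟪x s, x t⟫ := by
  have h1 : ∀ y : E, ∫ t in (0 : ℝ)..A, ⟪y, x t⟫ = ⟪y, ∫ t in (0 : ℝ)..A, x t⟫ := fun y =>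
    (innerSL ℝ y).intervalIntegral_comp_comm (hx.intervalIntegrable 0 A)
  have h2 : ∀ y : E, ∫ s in (0 : ℝ)..A, ⟪x s, y⟫ = ⟪y, ∫ s in (0 : ℝ)..A, x s⟫ := fun y => by
    simp_rw [real_inner_comm y]
    exact h1 y
  simp_rw [h1, h2]
  exact real_inner_self_nonneg

/-- Divided by `A`, the double integral tends to `∫ f`: with `s = A r` the inner integral runs over
`[A r - A, A r]`, which exhausts the line for `0 < r < 1`. -/
theorem integral_nonneg_of_integral_integral_nonneg {f : ℝ → ℝ} (hf : Integrable f)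
    (h : ∀ A : ℝ, 0 < A → 0 ≤ ∫ s in (0 : ℝ)..A, ∫ t in (0 : ℝ)..A, f (s - t)) :
    0 ≤ ∫ t, f t := by
  have hii : ∀ a b, IntervalIntegrable f volume a b := fun a b => hf.intervalIntegrable
  have hmean : ∀ n : ℕ, 0 ≤ ∫ r in (0 : ℝ)..1,
      ∫ t in ((n : ℝ) + 1) * r - ((n : ℝ) + 1)..((n : ℝ) + 1) * r, f t := by
    intro n
    have hn : (0 : ℝ) < (n : ℝ) + 1 := by positivity
    have h1 := h _ hn
    have h2 := intervalIntegral.smul_integral_comp_mul_left (a := 0) (b := 1)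
      (fun s => ∫ t in (0 : ℝ)..((n : ℝ) + 1), f (s - t)) ((n : ℝ) + 1)
    rw [mul_zero, mul_one] at h2
    rw [← h2, smul_eq_mul] at h1
    have h3 := nonneg_of_mul_nonneg_right h1 hn
    simpa only [intervalIntegral.integral_comp_sub_left, sub_zero] using h3
  have hlim : Tendsto (fun n : ℕ => ∫ r in (0 : ℝ)..1,
      ∫ t in ((n : ℝ) + 1) * r - ((n : ℝ) + 1)..((n : ℝ) + 1) * r, f t) atTop
      (𝓝 (∫ _ in (0 : ℝ)..1, ∫ t, f t)) := by
    refine intervalIntegral.tendsto_integral_filter_of_dominated_convergence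
      (fun _ => ∫ t, ‖f t‖) ?_ ?_ intervalIntegrable_const ?_
    · refine Eventually.of_forall fun n => Continuous.aestronglyMeasurable ?_
      have hc := intervalIntegral.continuous_primitive hii 0
      have e : (fun r : ℝ => ∫ t in ((n : ℝ) + 1) * r - ((n : ℝ) + 1)..((n : ℝ) + 1) * r, f t)
          = fun r => (∫ t in (0 : ℝ)..((n : ℝ) + 1) * r, f t)
            - ∫ t in (0 : ℝ)..((n : ℝ) + 1) * r - ((n : ℝ) + 1), f t := by
        funext r
        exact (intervalIntegral.integral_interval_sub_left (hii 0 _) (hii 0 _)).symm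
      rw [e]
      exact (hc.comp (by fun_prop)).sub (hc.comp (by fun_prop))
    · refine Eventually.of_forall fun n => Eventually.of_forall fun r _ => ?_
      refine intervalIntegral.norm_integral_le_integral_norm_uIoc.trans ?_
      exact setIntegral_le_integral hf.norm (Eventually.of_forall fun _ => norm_nonneg _)
    · have h1 : ∀ᵐ r : ℝ, r ≠ 1 := by simp [ae_iff]
      filter_upwards [h1] with r hr1 hr
      rw [Set.uIoc_of_le zero_le_one] at hr
      have hlt : r < 1 := lt_of_le_of_ne hr.2 hr1
      have hN : Tendsto (fun n : ℕ => (n : ℝ) + 1) atTop atTop :=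
        tendsto_natCast_atTop_atTop.atTop_add tendsto_const_nhds
      refine intervalIntegral_tendsto_integral hf ?_ (hN.atTop_mul_const hr.1)
      have : (fun n : ℕ => ((n : ℝ) + 1) * r - ((n : ℝ) + 1))
          = fun n : ℕ => ((n : ℝ) + 1) * (r - 1) := by funext n; ring
      rw [this]
      exact hN.atTop_mul_const_of_neg (by linarith)
  rw [intervalIntegral.integral_const, sub_zero, one_smul] at hlim
  exact ge_of_tendsto' hlim hmean

end PositiveDefinite

/-! ### Spectral densities of scalar correlation functions and Fourier inversion -/

/-- The spectral density `∫ R(τ) e^{-jwτ} dτ` of a correlation function. -/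
def spectralDensity (R : ℝ → ℝ) (w : ℝ) : ℂ :=
  ∫ τ : ℝ, (R τ : ℂ) * Complex.exp (-(Complex.I * w * τ))

theorem integrable_mul_exp_neg {R : ℝ → ℝ} (hR : Integrable R) (w : ℝ) :
    Integrable (fun τ : ℝ => (R τ : ℂ) * Complex.exp (-(Complex.I * w * τ))) := by
  refine hR.ofReal.mul_bdd (c := 1) (Continuous.aestronglyMeasurable (by fun_prop))
    (Eventually.of_forall fun τ => ?_)
  rw [norm_exp_neg_I_mul]

theorem norm_spectralDensity_le_integral (R : ℝ → ℝ) (w : ℝ) :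
    ‖spectralDensity R w‖ ≤ ∫ τ, ‖R τ‖ := by
  refine (norm_integral_le_integral_norm _).trans_eq ?_
  simp [norm_exp_neg_I_mul]

theorem conj_spectralDensity (R : ℝ → ℝ) (w : ℝ) :
    (starRingEnd ℂ) (spectralDensity R w) = spectralDensity R (-w) := by
  unfold spectralDensity
  rw [← integral_conj]
  refine integral_congr_ae (Eventually.of_forall fun τ => ?_)
  simp [← Complex.exp_conj]

theorem spectralDensity_neg {R R' : ℝ → ℝ} (h : ∀ τ, R' τ = R (-τ)) (w : ℝ) :
    spectralDensity R (-w) = spectralDensity R' w := by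
  unfold spectralDensity
  rw [← integral_neg_eq_self]
  refine integral_congr_ae (Eventually.of_forall fun τ => ?_)
  simp [h]

theorem fourier_eq_spectralDensity (R : ℝ → ℝ) (w : ℝ) :
    FourierTransform.fourier (fun τ => (R τ : ℂ)) w = spectralDensity R (2 * Real.pi * w) := by
  rw [Real.fourier_real_eq_integral_exp_smul]
  refine integral_congr_ae (Eventually.of_forall fun τ => ?_)
  dsimp only
  rw [smul_eq_mul, mul_comm]
  congr 2
  push_cast
  ring

theorem continuous_spectralDensity {R : ℝ → ℝ} (hR : Integrable R) :
    Continuous (spectralDensity R) := by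
  refine continuous_of_dominated (bound := fun τ => ‖R τ‖)
    (fun w => (integrable_mul_exp_neg hR w).1) (fun w => Eventually.of_forall fun τ => ?_) hR.norm
    (Eventually.of_forall fun τ => by fun_prop)
  rw [norm_mul, norm_exp_neg_I_mul, mul_one, Complex.norm_real]

/-- Fourier inversion for correlation functions. -/
theorem eq_synthesis_spectralDensity {R : ℝ → ℝ} (hc : Continuous R) (hR : Integrable R)
    (hS : Integrable (spectralDensity R)) (τ : ℝ) :
    (R τ : ℂ) = synthesis (fun w => (2 * Real.pi : ℂ)⁻¹ * spectralDensity R w) τ := by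
  have hpi : (0 : ℝ) < 2 * Real.pi := by positivity
  have hF : FourierTransform.fourier (fun τ => (R τ : ℂ))
      = fun w => spectralDensity R (2 * Real.pi * w) := funext (fourier_eq_spectralDensity R)
  have h := congrFun (Continuous.fourierInv_fourier_eq (f := fun τ => (R τ : ℂ)) (by fun_prop)
    hR.ofReal (by rw [hF]; exact hS.comp_mul_left' hpi.ne')) τ
  rw [← h, hF, Real.fourierInv_eq', synthesis_const_mul, synthesis]
  have h2 := Measure.integral_comp_mul_left
    (fun w : ℝ => spectralDensity R w * Complex.exp (Complex.I * w * τ)) (2 * Real.pi)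
  rw [abs_of_pos (by positivity), Complex.real_smul] at h2
  push_cast at h2
  rw [← h2]
  refine integral_congr_ae (Eventually.of_forall fun w => ?_)
  dsimp only
  rw [smul_eq_mul, mul_comm]
  congr 2
  simp
  ring

/-- A continuous integrable function with nonnegative Fourier transform has an integrable Fourier
transform. -/
theorem integrable_spectralDensity_of_nonneg {R : ℝ → ℝ} (hc : Continuous R) (hR : Integrable R)
    (him : ∀ w, (spectralDensity R w).im = 0) (hre : ∀ w, 0 ≤ (spectralDensity R w).re) :
    Integrable (spectralDensity R) := by
  have hpi : (0 : ℝ) < 2 * Real.pi := by positivity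
  set s : ℝ → ℝ := fun w => (spectralDensity R (2 * Real.pi * w)).re with hs
  have hsC : ∀ w, FourierTransform.fourier (fun τ => (R τ : ℂ)) w = (s w : ℂ) := by
    intro w
    rw [fourier_eq_spectralDensity]
    exact Complex.ext rfl (him _)
  have hsc : Continuous s :=
    Complex.continuous_re.comp ((continuous_spectralDensity hR).comp (by fun_prop))
  have hsb : ∀ w, ‖s w‖ ≤ ∫ τ, ‖R τ‖ := by
    intro w
    exact (Complex.abs_re_le_norm _).trans (norm_spectralDensity_le_integral _ _)
  -- Averages of `R` against shrinking Gaussians converge to `R 0`. Moving the Fourier transform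
  -- from the Gaussian onto `R` turns them into integrals of `s` with weights increasing to one.
  have hlim := Real.tendsto_integral_gaussian_smul' (V := ℝ) (f := fun τ => (R τ : ℂ)) hR.ofReal
    (v := 0) (by fun_prop)
  have hgauss : ∀ᶠ c : ℝ in atTop, ∫ w : ℝ, ((Real.pi * c : ℂ) ^ (Module.finrank ℝ ℝ / 2 : ℂ)
      * Complex.exp (-Real.pi ^ 2 * c * ‖(0 : ℝ) - w‖ ^ 2)) • (R w : ℂ)
      = ((∫ w, Real.exp (-c⁻¹ * w ^ 2) * s w : ℝ) : ℂ) := by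
    filter_upwards [Ioi_mem_atTop 0] with c (hc0 : 0 < c)
    have J : Integrable (fun w : ℝ => Complex.exp (-c⁻¹ * ‖w‖ ^ 2 + 2 * Real.pi * Complex.I
        * inner ℝ (0 : ℝ) w)) :=
      GaussianFourier.integrable_cexp_neg_mul_sq_norm_add (by simpa) _ _
    have hRc : Integrable (fun τ => (R τ : ℂ)) volume := hR.ofReal
    have B := (VectorFourier.integral_fourierIntegral_smul_eq_flip (L := innerₗ ℝ)
      (μ := volume) (ν := volume) Real.continuous_fourierChar continuous_inner J hRc)
    have e1 : ∀ w : ℝ, VectorFourier.fourierIntegral Real.fourierChar volume (innerₗ ℝ)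
        (fun w : ℝ => Complex.exp (-c⁻¹ * ‖w‖ ^ 2 + 2 * Real.pi * Complex.I
          * inner ℝ (0 : ℝ) w)) w = (Real.pi * c : ℂ) ^ (Module.finrank ℝ ℝ / 2 : ℂ)
      * Complex.exp (-Real.pi ^ 2 * c * ‖(0 : ℝ) - w‖ ^ 2) := by
      intro w
      have := fourier_gaussian_innerProductSpace' (V := ℝ) (b := (c⁻¹ : ℂ)) (by simpa) 0 w
      rw [show (Real.pi / (c⁻¹ : ℂ)) = Real.pi * c by simp] at this
      refine (Eq.trans ?_ this).trans ?_
      · simp only [Complex.ofReal_inv]; rfl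
      · congr 2; simp; ring
    have e2 : ∀ w : ℝ, VectorFourier.fourierIntegral Real.fourierChar volume (innerₗ ℝ).flip
        (fun τ => (R τ : ℂ)) w = (s w : ℂ) := by
      intro w
      rw [← hsC w]
      simp only [flip_innerₗ]
      rfl
    simp only [e1, e2] at B
    rw [B, ← integral_complex_ofReal]
    refine integral_congr_ae (Eventually.of_forall fun w => ?_)
    have habs : ((|w| : ℝ) : ℂ) ^ 2 = (w : ℂ) ^ 2 := by
      rw [← Complex.ofReal_pow, sq_abs, Complex.ofReal_pow]
    simp [habs]
  have hlim' : Tendsto (fun c : ℝ => ∫ w, Real.exp (-c⁻¹ * w ^ 2) * s w) atTop (𝓝 (R 0)) := by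
    have := (Complex.continuous_re.tendsto _).comp (hlim.congr' hgauss)
    simpa [Function.comp_def] using this
  have hnat : Tendsto (fun n : ℕ => ∫ w, Real.exp (-((n : ℝ) + 1)⁻¹ * w ^ 2) * s w) atTop
      (𝓝 (R 0)) :=
    hlim'.comp (tendsto_natCast_atTop_atTop.atTop_add tendsto_const_nhds)
  -- Fatou: the weighted functions are nonnegative, so their `L¹` norms equal their integrals, and
  -- these converge to the finite value `R 0`.
  have hsi : Integrable s := by
    refine integrable_of_tendsto
      (G := fun n w => Real.exp (-((n : ℝ) + 1)⁻¹ * w ^ 2) * s w) ?_ ?_ ?_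
    · refine Eventually.of_forall fun w => ?_
      have h0 : Tendsto (fun n : ℕ => ((n : ℝ) + 1)⁻¹) atTop (𝓝 0) := by
        simpa [one_div] using tendsto_one_div_add_atTop_nhds_zero_nat (𝕜 := ℝ)
      have := ((Real.continuous_exp.tendsto _).comp (h0.neg.mul_const (w ^ 2))).mul_const (s w)
      simpa using this
    · intro n
      exact Continuous.aestronglyMeasurable (by fun_prop)
    · have hi : ∀ n : ℕ, ∫⁻ w, ‖Real.exp (-((n : ℝ) + 1)⁻¹ * w ^ 2) * s w‖ₑ
          = ENNReal.ofReal (∫ w, Real.exp (-((n : ℝ) + 1)⁻¹ * w ^ 2) * s w) := by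
        intro n
        have hpos : ∀ w, 0 ≤ Real.exp (-((n : ℝ) + 1)⁻¹ * w ^ 2) * s w := fun w =>
          mul_nonneg (Real.exp_nonneg _) (hre _)
        have hint : Integrable fun w => Real.exp (-((n : ℝ) + 1)⁻¹ * w ^ 2) * s w :=
          (integrable_exp_neg_mul_sq (by positivity)).mul_bdd hsc.aestronglyMeasurable
            (Eventually.of_forall hsb)
        rw [ofReal_integral_eq_lintegral_ofReal hint (Eventually.of_forall hpos)]
        exact lintegral_congr fun w => Real.enorm_of_nonneg (hpos w)
      simp only [hi]
      have ht := (ENNReal.continuous_ofReal.tendsto _).comp hnat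
      rw [Function.comp_def] at ht
      rw [ht.liminf_eq]
      exact ENNReal.ofReal_ne_top
  have h2 : Integrable fun w => spectralDensity R (2 * Real.pi * w) := by
    have : (fun w => spectralDensity R (2 * Real.pi * w)) = fun w => (s w : ℂ) := by
      funext w; rw [← fourier_eq_spectralDensity, hsC]
    rw [this]
    exact hsi.ofReal
  exact (integrable_comp_mul_left_iff _ hpi.ne').1 h2

/-! ### Stationary curves in a Hilbert space -/

section Stationary

open scoped RealInnerProductSpace

variable {E : Type*} [NormedAddCommGroup E] [InnerProductSpace ℝ E]
  {ι : Type*} {u : ι → ℝ → E} {R : ι → ι → ℝ → ℝ}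

theorem correlation_neg (h : ∀ i j s t, ⟪u i s, u j t⟫ = R i j (s - t)) (i j : ι) (τ : ℝ) :
    R j i τ = R i j (-τ) := by
  have h1 := h j i τ 0
  have h2 := h i j 0 τ
  rw [sub_zero] at h1
  rw [zero_sub] at h2
  rw [← h1, ← h2, real_inner_comm]

theorem continuous_correlation (hu : ∀ i, Continuous (u i))
    (h : ∀ i j s t, ⟪u i s, u j t⟫ = R i j (s - t)) (i j : ι) : Continuous (R i j) := by
  have : R i j = fun τ => ⟪u i τ, u j 0⟫ := by funext τ; rw [h, sub_zero]
  rw [this]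
  have := hu i
  fun_prop

theorem conj_spectralDensity_comm (h : ∀ i j s t, ⟪u i s, u j t⟫ = R i j (s - t)) (i j : ι)
    (w : ℝ) : (starRingEnd ℂ) (spectralDensity (R i j) w) = spectralDensity (R j i) w := by
  rw [conj_spectralDensity, spectralDensity_neg (correlation_neg h i j)]

theorem spectralDensity_self_im (h : ∀ i j s t, ⟪u i s, u j t⟫ = R i j (s - t)) (i : ι) (w : ℝ) :
    (spectralDensity (R i i) w).im = 0 :=
  Complex.conj_eq_iff_im.1 (conj_spectralDensity_comm h i i w)

variable [CompleteSpace E]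

/-- The expression is the spectral density at `w` of the complex combination `u i + c • u j`. Since
`E` is real, the modulated curve `e^{-jwt}(u i + c • u j)` is split into its real part `x` and
imaginary part `y`, each contributing a nonnegative double integral. -/
theorem spectralDensity_form_nonneg (hu : ∀ i, Continuous (u i))
    (h : ∀ i j s t, ⟪u i s, u j t⟫ = R i j (s - t)) (hR : ∀ i j, Integrable (R i j)) (i j : ι)
    (c : ℂ) (w : ℝ) :
    0 ≤ (spectralDensity (R i i) w + (starRingEnd ℂ) c * spectralDensity (R i j) w
      + c * spectralDensity (R j i) w
      + c * (starRingEnd ℂ) c * spectralDensity (R j j) w).re := by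
  set e : ℝ → ℂ := fun t => Complex.exp (-(Complex.I * w * t)) with he
  have hec : Continuous e := by simp only [he]; fun_prop
  have hadd : ∀ s t, e (s - t) = e s * (starRingEnd ℂ) (e t) := by
    intro s t
    simp only [he, ← Complex.exp_conj, ← Complex.exp_add]
    congr 1
    simp
    ring
  let F : ℝ → ℂ := fun τ => (R i i τ : ℂ) * e τ + (starRingEnd ℂ) c * ((R i j τ : ℂ) * e τ)
    + c * ((R j i τ : ℂ) * e τ) + c * (starRingEnd ℂ) c * ((R j j τ : ℂ) * e τ)
  have hI := fun i j => integrable_mul_exp_neg (hR i j) w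
  have hF : Integrable F :=
    (((hI i i).add ((hI i j).const_mul _)).add ((hI j i).const_mul _)).add ((hI j j).const_mul _)
  have hFint : ∫ τ, F τ = spectralDensity (R i i) w + (starRingEnd ℂ) c * spectralDensity (R i j) w
      + c * spectralDensity (R j i) w
      + c * (starRingEnd ℂ) c * spectralDensity (R j j) w := by
    simp only [F]
    rw [integral_add (by exact ((hI i i).add ((hI i j).const_mul _)).add ((hI j i).const_mul _))
        ((hI j j).const_mul _),
      integral_add (by exact (hI i i).add ((hI i j).const_mul _)) ((hI j i).const_mul _),
      integral_add (hI i i) ((hI i j).const_mul _), integral_const_mul, integral_const_mul,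
      integral_const_mul]
    rfl
  rw [← hFint]
  have hre : (∫ τ, F τ).re = ∫ τ, (F τ).re := (integral_re hF).symm
  rw [hre]
  refine integral_nonneg_of_integral_integral_nonneg hF.re fun A _ => ?_
  let x : ℝ → E := fun t => (e t).re • u i t + (c * e t).re • u j t
  let y : ℝ → E := fun t => (e t).im • u i t + (c * e t).im • u j t
  have hui := hu i
  have huj := hu j
  have hxc : Continuous x := by simp only [x]; fun_prop
  have hyc : Continuous y := by simp only [y]; fun_prop
  have key : ∀ s t, (F (s - t)).re = ⟪x s, x t⟫ + ⟪y s, y t⟫ := by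
    intro s t
    simp only [x, y, inner_add_left, inner_add_right, real_inner_smul_left, real_inner_smul_right,
      h, F, hadd]
    simp
    ring
  have h1 := integral_integral_inner_nonneg hxc A
  have h2 := integral_integral_inner_nonneg hyc A
  have hin : ∀ z : ℝ → E, Continuous z → ∀ s, IntervalIntegrable (fun t => ⟪z s, z t⟫) volume 0 A :=
    fun z hz s => Continuous.intervalIntegrable (by fun_prop) _ _
  have hout : ∀ z : ℝ → E, Continuous z →
      IntervalIntegrable (fun s => ∫ t in (0 : ℝ)..A, ⟪z s, z t⟫) volume 0 A := by
    intro z hz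
    refine Continuous.intervalIntegrable ?_ _ _
    exact intervalIntegral.continuous_parametric_intervalIntegral_of_continuous' (by fun_prop) _ _
  have hsum : ∫ s in (0 : ℝ)..A, ∫ t in (0 : ℝ)..A, (F (s - t)).re
      = (∫ s in (0 : ℝ)..A, ∫ t in (0 : ℝ)..A, ⟪x s, x t⟫)
        + ∫ s in (0 : ℝ)..A, ∫ t in (0 : ℝ)..A, ⟪y s, y t⟫ := by
    rw [← intervalIntegral.integral_add (hout x hxc) (hout y hyc)]
    refine intervalIntegral.integral_congr fun s _ => ?_
    rw [← intervalIntegral.integral_add (hin x hxc s) (hin y hyc s)]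
    exact intervalIntegral.integral_congr fun t _ => key s t
  have : 0 ≤ ∫ s in (0 : ℝ)..A, ∫ t in (0 : ℝ)..A, (F (s - t)).re := by
    rw [hsum]; exact add_nonneg h1 h2
  exact this

theorem spectralDensity_self_nonneg (hu : ∀ i, Continuous (u i))
    (h : ∀ i j s t, ⟪u i s, u j t⟫ = R i j (s - t)) (hR : ∀ i j, Integrable (R i j)) (i : ι)
    (w : ℝ) : 0 ≤ (spectralDensity (R i i) w).re := by
  simpa using spectralDensity_form_nonneg hu h hR i i 0 w

theorem norm_spectralDensity_le (hu : ∀ i, Continuous (u i))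
    (h : ∀ i j s t, ⟪u i s, u j t⟫ = R i j (s - t)) (hR : ∀ i j, Integrable (R i j)) (i j : ι)
    (w : ℝ) : 2 * ‖spectralDensity (R i j) w‖
      ≤ (spectralDensity (R i i) w).re + (spectralDensity (R j j) w).re := by
  set z := spectralDensity (R i j) w with hz
  by_cases hz0 : z = 0
  · have h1 := spectralDensity_self_nonneg hu h hR i w
    have h2 := spectralDensity_self_nonneg hu h hR j w
    rw [hz0, norm_zero]
    linarith
  have hn : (‖z‖ : ℂ) ≠ 0 := by simpa using hz0
  -- The unimodular coefficient is chosen so that both cross terms become `-‖z‖`.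
  have hf := spectralDensity_form_nonneg hu h hR i j (-(z / ‖z‖)) w
  rw [← conj_spectralDensity_comm h i j w, ← hz] at hf
  have e1 : (starRingEnd ℂ) (-(z / ‖z‖)) * z = ((-‖z‖ : ℝ) : ℂ) := by
    have := Complex.conj_mul' z
    simp only [map_neg, map_div₀, Complex.conj_ofReal]
    push_cast
    field_simp
    rw [this]
  have e2 : -(z / ‖z‖) * (starRingEnd ℂ) z = ((-‖z‖ : ℝ) : ℂ) := by
    have := Complex.mul_conj' z
    push_cast
    field_simp
    rw [this]
  have e3 : -(z / ‖z‖) * (starRingEnd ℂ) (-(z / ‖z‖)) = 1 := by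
    have := Complex.mul_conj' z
    simp only [map_neg, map_div₀, Complex.conj_ofReal]
    field_simp
    rw [← this]
  rw [e1, e2, e3, one_mul] at hf
  simp only [Complex.add_re, Complex.ofReal_re] at hf
  linarith

/-- Diagonal densities are nonnegative, hence integrable; cross densities are dominated by them. -/
theorem integrable_spectralDensity (hu : ∀ i, Continuous (u i))
    (h : ∀ i j s t, ⟪u i s, u j t⟫ = R i j (s - t)) (hR : ∀ i j, Integrable (R i j)) (i j : ι) :
    Integrable (spectralDensity (R i j)) := by
  have hd := fun i => (integrable_spectralDensity_of_nonneg (continuous_correlation hu h i i)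
    (hR i i) (spectralDensity_self_im h i) (spectralDensity_self_nonneg hu h hR i)).re
  refine ((hd i).add (hd j)).mono' (continuous_spectralDensity (hR i j)).aestronglyMeasurable
    (Eventually.of_forall fun w => ?_)
  have := norm_spectralDensity_le hu h hR i j w
  exact le_trans (by linarith [norm_nonneg (spectralDensity (R i j) w)]) this

end Stationary

theorem conj_synthesis (F : ℝ → ℂ) (t : ℝ) :
    (starRingEnd ℂ) (synthesis F t) = synthesis (fun w => (starRingEnd ℂ) (F w)) (-t) := by
  unfold synthesis
  rw [← integral_conj]
  refine integral_congr_ae (Eventually.of_forall fun w => ?_)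
  simp [← Complex.exp_conj]

namespace Params

/-! ### The spectrum of the acceleration -/

section Spectrum

variable {ι : Type*} [Fintype ι] (p : Params ι)

theorem conj_charFun (s : ℂ) : (starRingEnd ℂ) (p.charFun s) = p.charFun ((starRingEnd ℂ) s) := by
  simp [charFun, ← Complex.exp_conj]

theorem conj_transfer (i : ι) (s : ℂ) :
    (starRingEnd ℂ) (p.transfer i s) = p.transfer i ((starRingEnd ℂ) s) := by
  unfold transfer
  split_ifs <;> simp [← Complex.exp_conj, conj_charFun]

/-- The term of the spectral density of the acceleration due to the correlation function `R`. -/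
def accelDensity (R : ℝ → ℝ) (i j : ι) (w : ℝ) : ℂ :=
  (w : ℂ) ^ 2 * p.transfer i (Complex.I * w)
    * (starRingEnd ℂ) (p.transfer j (Complex.I * w)) * spectralDensity R w

variable {p}

/-- The factor `w²` is shared out, one `w` to each transfer function, so the coefficient of the
spectral density is bounded. -/
theorem integrable_accelDensity (h : p.PlantStable) {R : ℝ → ℝ}
    (hS : Integrable (spectralDensity R)) (i j : ι) : Integrable (p.accelDensity R i j) := by
  obtain ⟨K, hK⟩ := h.exists_transfer_le i
  obtain ⟨L, hL⟩ := h.exists_transfer_le j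
  have hi := h.continuous_transfer i
  have hj := h.continuous_transfer j
  refine hS.bdd_mul (c := K * L) (Continuous.aestronglyMeasurable (by fun_prop))
    (Eventually.of_forall fun w => ?_)
  have h1 := (norm_le_of_weighted hK w).2
  have h2 := (norm_le_of_weighted hL w).2
  have e : ‖(w : ℂ) ^ 2 * p.transfer i (Complex.I * w)
      * (starRingEnd ℂ) (p.transfer j (Complex.I * w))‖
      = ‖Complex.I * w * p.transfer i (Complex.I * w)‖
        * ‖Complex.I * w * p.transfer j (Complex.I * w)‖ := by
    simp only [norm_mul, norm_pow, Complex.norm_I, RCLike.norm_conj]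
    ring
  rw [e]
  exact mul_le_mul h1 h2 (norm_nonneg _) ((norm_nonneg _).trans h1)

theorem accelDensity_neg (R : ℝ → ℝ) (i j : ι) (w : ℝ) :
    p.accelDensity R i j (-w) = (starRingEnd ℂ) (p.accelDensity R i j w) := by
  have e : Complex.I * ((-w : ℝ) : ℂ) = (starRingEnd ℂ) (Complex.I * w) := by simp
  have et : ∀ i, p.transfer i (Complex.I * ((-w : ℝ) : ℂ))
      = (starRingEnd ℂ) (p.transfer i (Complex.I * w)) := fun i => by rw [e, conj_transfer]
  unfold accelDensity
  rw [et, et, map_mul, map_mul, map_mul, conj_spectralDensity]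
  simp

theorem conj_accelDensity {R R' : ℝ → ℝ} {w : ℝ}
    (h : (starRingEnd ℂ) (spectralDensity R w) = spectralDensity R' w) (i j : ι) :
    (starRingEnd ℂ) (p.accelDensity R i j w) = p.accelDensity R' j i w := by
  unfold accelDensity
  rw [map_mul, map_mul, map_mul, h, Complex.conj_conj, map_pow, Complex.conj_ofReal]
  ring

theorem integral_eq_two_mul_integral_Ioi {f : ℝ → ℂ} (hf : Integrable f)
    (he : ∀ w, f (-w) = f w) : ∫ w, f w = 2 * ∫ w in Set.Ioi 0, f w := by
  rw [← intervalIntegral.integral_Iic_add_Ioi (b := 0) hf.integrableOn hf.integrableOn]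
  have := integral_comp_neg_Iic 0 f
  rw [neg_zero] at this
  rw [← this, two_mul]
  simp only [he]

/-- A single term need not be even in `w`, but reflection conjugates the `(i, j)` term, which turns
it into the `(j, i)` term. The double sum is therefore even. -/
theorem sum_integral_accelDensity (h : p.PlantStable) {R : ι → ι → ℝ → ℝ}
    (hS : ∀ i j, Integrable (spectralDensity (R i j)))
    (hc : ∀ i j w, (starRingEnd ℂ) (spectralDensity (R i j) w) = spectralDensity (R j i) w) :
    ∑ i, ∑ j, ∫ w in Set.Ioi (0 : ℝ), p.accelDensity (R i j) i j w
      = (∫ w, ∑ i, ∑ j, p.accelDensity (R i j) i j w) / 2 := by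
  have hi := fun i j => integrable_accelDensity h (hS i j) i j
  rw [integral_eq_two_mul_integral_Ioi
    (integrable_finsetSum Finset.univ fun i _ =>
      integrable_finsetSum Finset.univ fun j _ => hi i j),
    mul_div_cancel_left₀ _ two_ne_zero, integral_finsetSum _ fun i _ =>
      (integrable_finsetSum Finset.univ fun j _ => hi i j).integrableOn]
  · exact Finset.sum_congr rfl fun i _ =>
      (integral_finsetSum _ fun j _ => (hi i j).integrableOn).symm
  · intro w
    rw [Finset.sum_comm]
    refine Finset.sum_congr rfl fun i _ => Finset.sum_congr rfl fun j _ => ?_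
    rw [accelDensity_neg, conj_accelDensity (hc j i w)]

end Spectrum

/-! ### Steady-state responses in a Hilbert space -/

open scoped RealInnerProductSpace

variable {ι : Type*} [Fintype ι] {p : Params ι}
  {E : Type*} [NormedAddCommGroup E] [InnerProductSpace ℝ E]

/-- The right-hand side of the speed equation, for Hilbert space valued curves. -/
def hilbertAccel (p : Params ι) (u : ι → ℝ → E) (x y : ℝ → E) (t : ℝ) : E :=
  p.α • (p.κ • x (t - p.σ) - y (t - p.σ))
    + ∑ i, p.β i • (u i (t - (p.σ + p.δ i)) - y (t - p.σ))

/-- A bounded solution of the linearized dynamics in a Hilbert space, on the whole time axis. -/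
structure IsHilbertResponse (p : Params ι) (u : ι → ℝ → E) (x y : ℝ → E) : Prop where
  bounded_left : ∃ C : ℝ, ∀ t, ‖x t‖ ≤ C
  bounded_right : ∃ C : ℝ, ∀ t, ‖y t‖ ≤ C
  hasDerivAt_left : ∀ t, HasDerivAt x (u p.one t - y t) t
  hasDerivAt_right : ∀ t, HasDerivAt y (p.hilbertAccel u x y t) t

namespace IsHilbertResponse

variable {u : ι → ℝ → E} {x y : ℝ → E}

/-- Pairing with a fixed vector commutes with derivatives and with the linear right-hand side, so
the scalar theory applies. -/
theorem isBoundedSolution (hr : p.IsHilbertResponse u x y) (e : E) :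
    p.IsBoundedSolution (fun i t => (⟪u i t, e⟫ : ℂ)) (fun t => (⟪x t, e⟫ : ℂ))
      (fun t => (⟪y t, e⟫ : ℂ)) := by
  have hb : ∀ z : ℝ → E, (∃ C : ℝ, ∀ t, ‖z t‖ ≤ C) → ∃ C : ℝ, ∀ t, ‖(⟪z t, e⟫ : ℂ)‖ ≤ C := by
    rintro z ⟨C, hC⟩
    refine ⟨C * ‖e‖, fun t => ?_⟩
    rw [Complex.norm_real]
    exact (norm_inner_le_norm _ _).trans (by gcongr; exact hC t)
  have hd : ∀ (z : ℝ → E) (z' : E) (t : ℝ), HasDerivAt z z' t →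
      HasDerivAt (fun t => (⟪z t, e⟫ : ℂ)) (⟪z', e⟫ : ℂ) t := by
    intro z z' t h
    have := (h.inner ℝ (hasDerivAt_const t e)).ofReal_comp
    simpa using this
  refine ⟨hb x hr.bounded_left, hb y hr.bounded_right, fun t => ?_, fun t => ?_⟩
  · refine (hd x _ t (hr.hasDerivAt_left t)).congr_deriv ?_
    rw [inner_sub_left]; push_cast; rfl
  · refine (hd y _ t (hr.hasDerivAt_right t)).congr_deriv ?_
    simp only [hilbertAccel, inner_add_left, inner_sub_left, sum_inner, real_inner_smul_left]
    push_cast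
    rfl

variable [CompleteSpace E]

/-- The steady-state response lies in the closed span of the inputs. -/
theorem mem_closure_span (hr : p.IsHilbertResponse u x y) (h : p.PlantStable) (t : ℝ) :
    x t ∈ (Submodule.span ℝ (Set.range fun q : ι × ℝ => u q.1 q.2)).topologicalClosure ∧
    y t ∈ (Submodule.span ℝ (Set.range fun q : ι × ℝ => u q.1 q.2)).topologicalClosure := by
  -- Against such an `e` all inputs vanish, so by uniqueness the response does too; the double
  -- orthogonal complement is the closed span.
  have key : ∀ e ∈ (Submodule.span ℝ (Set.range fun q : ι × ℝ => u q.1 q.2))ᗮ,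
      ⟪x t, e⟫ = 0 ∧ ⟪y t, e⟫ = 0 := by
    intro e he
    have hu : ∀ i t, ⟪u i t, e⟫ = 0 := fun i t =>
      he _ (Submodule.subset_span ⟨(i, t), rfl⟩)
    have hs := hr.isBoundedSolution e
    simp only [hu] at hs
    have h0 : p.IsBoundedSolution (fun _ _ => ((0 : ℝ) : ℂ)) (fun _ => 0) (fun _ => 0) :=
      ⟨⟨0, by simp⟩, ⟨0, by simp⟩, fun t => by simpa using hasDerivAt_const t (0 : ℂ),
        fun t => by simpa using hasDerivAt_const t (0 : ℂ)⟩
    have := hs.unique h h0 t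
    exact_mod_cast this
  simp only [← Submodule.orthogonal_orthogonal_eq_closure]
  exact ⟨fun e he => by rw [real_inner_comm]; exact (key e he).1,
    fun e he => by rw [real_inner_comm]; exact (key e he).2⟩

theorem hilbertAccel_mem_closure_span (hr : p.IsHilbertResponse u x y) (h : p.PlantStable)
    (t : ℝ) : p.hilbertAccel u x y t ∈
      (Submodule.span ℝ (Set.range fun q : ι × ℝ => u q.1 q.2)).topologicalClosure := by
  have hx := fun t => (hr.mem_closure_span h t).1
  have hy := fun t => (hr.mem_closure_span h t).2
  have hu : ∀ i t, u i t ∈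
      (Submodule.span ℝ (Set.range fun q : ι × ℝ => u q.1 q.2)).topologicalClosure := fun i t =>
    Submodule.le_topologicalClosure _ (Submodule.subset_span ⟨(i, t), rfl⟩)
  exact Submodule.add_mem _ (Submodule.smul_mem _ _
      (Submodule.sub_mem _ (Submodule.smul_mem _ _ (hx _)) (hy _)))
    (Submodule.sum_mem _ fun i _ => Submodule.smul_mem _ _ (Submodule.sub_mem _ (hu _ _) (hy _)))

variable {R : ι → ι → ℝ → ℝ}

/-- Paired with `u j s`, the inputs become `R i j (t - s)`, harmonic superpositions by Fourier
inversion, with the factor `e^{-jws}` carrying the shift. -/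
theorem inner_input (hr : p.IsHilbertResponse u x y) (h : p.PlantStable)
    (hu : ∀ i, Continuous (u i)) (hR : ∀ i j s t, ⟪u i s, u j t⟫ = R i j (s - t))
    (hRi : ∀ i j, Integrable (R i j)) (j : ι) (t s : ℝ) :
    (⟪y t, u j s⟫ : ℂ) = synthesis (fun w => ∑ i, p.transfer i (Complex.I * w)
      * ((2 * Real.pi : ℂ)⁻¹ * spectralDensity (R i j) w)) (t - s) := by
  have hS := fun i => (integrable_spectralDensity hu hR hRi i j).const_mul (2 * Real.pi : ℂ)⁻¹
  have := (hr.isBoundedSolution (u j s)).eq_synthesis h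
    (F := fun i w => (2 * Real.pi : ℂ)⁻¹ * spectralDensity (R i j) w
      * Complex.exp (-(Complex.I * w * s)))
    (fun i => (hS i).mul_bdd (c := 1) (Continuous.aestronglyMeasurable (by fun_prop))
      (Eventually.of_forall fun w => (norm_exp_neg_I_mul w s).le))
    (fun i t => by
      rw [synthesis_shift, hR, eq_synthesis_spectralDensity (continuous_correlation hu hR i j)
        (hRi i j) (integrable_spectralDensity hu hR hRi i j)]) t
  rw [this, ← synthesis_shift]
  simp only [Finset.sum_mul, mul_assoc]

/-- Paired with `y s`, the inputs are the correlations given by `inner_input` with the arguments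
exchanged, which conjugates the transfer function. -/
theorem inner_self (hr : p.IsHilbertResponse u x y) (h : p.PlantStable)
    (hu : ∀ i, Continuous (u i)) (hR : ∀ i j s t, ⟪u i s, u j t⟫ = R i j (s - t))
    (hRi : ∀ i j, Integrable (R i j)) (t s : ℝ) :
    (⟪y t, y s⟫ : ℂ) = synthesis (fun w => ∑ i, p.transfer i (Complex.I * w)
      * ∑ j, (starRingEnd ℂ) (p.transfer j (Complex.I * w))
      * ((2 * Real.pi : ℂ)⁻¹ * spectralDensity (R i j) w)) (t - s) := by
  have hS := fun i j => (integrable_spectralDensity hu hR hRi i j).const_mul (2 * Real.pi : ℂ)⁻¹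
  have hT : ∀ i, Integrable fun w : ℝ => ∑ j, (starRingEnd ℂ) (p.transfer j (Complex.I * w))
      * ((2 * Real.pi : ℂ)⁻¹ * spectralDensity (R i j) w) := by
    refine fun i => integrable_finsetSum _ fun j _ => ?_
    obtain ⟨K, hK⟩ := h.exists_transfer_le j
    have := h.continuous_transfer j
    refine (hS i j).bdd_mul (c := K) (Continuous.aestronglyMeasurable (by fun_prop))
      (Eventually.of_forall fun w => ?_)
    rw [RCLike.norm_conj]
    exact (norm_le_of_weighted hK w).1
  have := (hr.isBoundedSolution (y s)).eq_synthesis h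
    (F := fun i w => (∑ j, (starRingEnd ℂ) (p.transfer j (Complex.I * w))
      * ((2 * Real.pi : ℂ)⁻¹ * spectralDensity (R i j) w)) * Complex.exp (-(Complex.I * w * s)))
    (fun i => (hT i).mul_bdd (c := 1) (Continuous.aestronglyMeasurable (by fun_prop))
      (Eventually.of_forall fun w => (norm_exp_neg_I_mul w s).le))
    (fun i t => by
      have h1 := hr.inner_input h hu hR hRi i s t
      have h2 := congrArg (starRingEnd ℂ) h1
      rw [Complex.conj_ofReal, conj_synthesis, neg_sub, real_inner_comm] at h2
      rw [h2, synthesis_shift]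
      congr 1
      funext w
      simp only [map_sum, map_mul, conj_spectralDensity_comm hR, map_inv₀, Complex.conj_ofReal,
        Complex.conj_ofNat]) t
  rw [this, ← synthesis_shift]
  simp only [Finset.sum_mul, mul_assoc]

/-- The acceleration is orthogonal to the speed at each time, and its norm is given by the
spectral formula. -/
theorem inner_hilbertAccel (hr : p.IsHilbertResponse u x y) (h : p.PlantStable)
    (hu : ∀ i, Continuous (u i)) (hR : ∀ i j s t, ⟪u i s, u j t⟫ = R i j (s - t))
    (hRi : ∀ i j, Integrable (R i j)) (t : ℝ) :
    ⟪y t, p.hilbertAccel u x y t⟫ = 0 ∧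
    ((‖p.hilbertAccel u x y t‖ : ℂ) ^ 2 = 1 / Real.pi * ∑ i, ∑ j, ∫ w in Set.Ioi (0 : ℝ),
      p.accelDensity (R i j) i j w) := by
  have hS := integrable_spectralDensity hu hR hRi
  let W : ℝ → ℂ := fun w => ∑ i, p.transfer i (Complex.I * w)
      * ∑ j, (starRingEnd ℂ) (p.transfer j (Complex.I * w))
      * ((2 * Real.pi : ℂ)⁻¹ * spectralDensity (R i j) w)
  have hself : ∀ t s, (⟪y t, y s⟫ : ℂ) = synthesis W (t - s) := hr.inner_self h hu hR hRi
  have hWi : Integrable W := by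
    refine integrable_finsetSum _ fun i _ => integrable_transfer_mul h i
      (integrable_finsetSum _ fun j _ => ?_)
    obtain ⟨K, hK⟩ := h.exists_transfer_le j
    have := h.continuous_transfer j
    refine ((hS i j).const_mul _).bdd_mul (c := K) (Continuous.aestronglyMeasurable (by fun_prop))
      (Eventually.of_forall fun w => ?_)
    rw [RCLike.norm_conj]
    exact (norm_le_of_weighted hK w).1
  have hW2 : ∀ w : ℝ, (w : ℂ) ^ 2 * W w
      = (2 * Real.pi : ℂ)⁻¹ * ∑ i, ∑ j, p.accelDensity (R i j) i j w := by
    intro w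
    simp only [W, accelDensity, Finset.mul_sum]
    exact Finset.sum_congr rfl fun i _ => Finset.sum_congr rfl fun j _ => by ring
  have hacc := integrable_finsetSum Finset.univ fun i _ => integrable_finsetSum Finset.univ
    fun j _ => integrable_accelDensity h (hS i j) i j
  have hW2i : Integrable fun w : ℝ => (w : ℂ) ^ 2 * W w := by
    simp only [hW2]
    exact hacc.const_mul _
  -- The first moment lies between the two already controlled, as `|w| ≤ 1 + w²`.
  have hW1i : Integrable fun w : ℝ => Complex.I * w * W w := by
    refine (hWi.norm.add hW2i.norm).mono'
      ((Continuous.aestronglyMeasurable (by fun_prop)).mul hWi.1) (Eventually.of_forall fun w => ?_)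
    have e1 : ‖Complex.I * w * W w‖ = |w| * ‖W w‖ := by simp
    have e2 : ‖(w : ℂ) ^ 2 * W w‖ = |w| ^ 2 * ‖W w‖ := by simp
    simp only [Pi.add_apply, e1, e2]
    nlinarith [norm_nonneg (W w), mul_nonneg (sq_nonneg (|w| - 1)) (norm_nonneg (W w)),
      mul_nonneg (sq_nonneg |w|) (norm_nonneg (W w))]
  have hd := hr.hasDerivAt_right
  have hcross : ∀ t s, (⟪p.hilbertAccel u x y t, y s⟫ : ℂ)
      = synthesis (fun w => Complex.I * w * W w) (t - s) := by
    intro t s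
    have h1 : HasDerivAt (fun t => (⟪y t, y s⟫ : ℂ)) (⟪p.hilbertAccel u x y t, y s⟫ : ℂ) t := by
      have := ((hd t).inner ℝ (hasDerivAt_const t (y s))).ofReal_comp
      simpa using this
    have h2 := (hasDerivAt_synthesis hWi hW1i (t - s)).comp_sub_const t s
    have e : (fun t => (⟪y t, y s⟫ : ℂ)) = fun t => synthesis W (t - s) := funext fun t => hself t s
    rw [e] at h1
    exact h1.unique h2
  have hIW : ∀ w : ℝ, Complex.I * w * (Complex.I * w * W w) = -((w : ℂ) ^ 2 * W w) := by
    intro w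
    linear_combination (w : ℂ) ^ 2 * W w * Complex.I_mul_I
  -- Differentiating in the second time brings down `-jw`, so the two derivatives together give
  -- `-(jw)² = w²`.
  have hcov : ∀ t s, (⟪p.hilbertAccel u x y t, p.hilbertAccel u x y s⟫ : ℂ)
      = synthesis (fun w => (w : ℂ) ^ 2 * W w) (t - s) := by
    intro t s
    have h1 : HasDerivAt (fun s => (⟪p.hilbertAccel u x y t, y s⟫ : ℂ))
        (⟪p.hilbertAccel u x y t, p.hilbertAccel u x y s⟫ : ℂ) s := by
      have := ((hasDerivAt_const s (p.hilbertAccel u x y t)).inner ℝ (hd s)).ofReal_comp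
      simpa using this
    have h2 := (hasDerivAt_synthesis hW1i (by simp only [hIW]; exact hW2i.neg)
      (t - s)).comp_const_sub t s
    simp only [hcross] at h1
    rw [h1.unique h2]
    simp only [hIW, synthesis, neg_mul, integral_neg, neg_neg]
  constructor
  · have h1 : HasDerivAt (fun t => ⟪y t, y t⟫) (⟪y t, p.hilbertAccel u x y t⟫
        + ⟪p.hilbertAccel u x y t, y t⟫) t := (hd t).inner ℝ (hd t)
    -- Stationarity makes `‖y t‖²` constant, and its derivative is twice the inner product in
    -- question.
    have e : (fun t => ⟪y t, y t⟫) = fun _ => ⟪y 0, y 0⟫ := by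
      funext t
      have : (⟪y t, y t⟫ : ℂ) = ⟪y 0, y 0⟫ := by rw [hself, hself, sub_self, sub_self]
      exact_mod_cast this
    rw [e] at h1
    have := h1.unique (hasDerivAt_const t _)
    rw [real_inner_comm (y t)] at this
    linarith
  · have h1 := hcov t t
    rw [real_inner_self_eq_norm_sq, sub_self] at h1
    rw [sum_integral_accelDensity h hS (conj_spectralDensity_comm hR), ← Complex.ofReal_pow, h1]
    simp only [synthesis, hW2, Complex.ofReal_zero, mul_zero, Complex.exp_zero, mul_one]
    rw [integral_const_mul]
    field_simp

end IsHilbertResponse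

end Params

/-! ### Mean-square calculus as calculus in `L²` -/

section MeanSquare

variable {Ω : Type*} [MeasurableSpace Ω] {P : Measure Ω}

open scoped RealInnerProductSpace

theorem IsMSDeriv.hasDerivAt_toLp {X X' : ℝ → Ω → ℝ} (h : IsMSDeriv P X X')
    (hX : ∀ t, MemLp (X t) 2 P) (t : ℝ) :
    HasDerivAt (fun t => (hX t).toLp (X t)) ((h t).1.toLp (X' t)) t := by
  rw [hasDerivAt_iff_tendsto_slope_zero, tendsto_iff_norm_sub_tendsto_zero]
  have h0 := (ENNReal.continuousAt_toReal ENNReal.zero_ne_top).tendsto.comp (h t).2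
  rw [ENNReal.toReal_zero] at h0
  refine h0.congr fun s => ?_
  rw [← MemLp.toLp_sub, ← MemLp.toLp_const_smul, ← MemLp.toLp_sub, Lp.norm_toLp]
  simp only [Function.comp_apply]
  congr 2
  funext ω
  simp only [Pi.sub_apply, Pi.smul_apply, smul_eq_mul]
  ring

theorem correlation_eq_inner {X Y : ℝ → Ω → ℝ} (hX : ∀ t, MemLp (X t) 2 P)
    (hY : ∀ t, MemLp (Y t) 2 P) (s t : ℝ) :
    correlation P X Y s t = ⟪(hX s).toLp (X s), (hY t).toLp (Y t)⟫ := by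
  rw [L2.inner_def]
  refine integral_congr_ae ?_
  filter_upwards [(hX s).coeFn_toLp, (hY t).coeFn_toLp] with ω h1 h2
  rw [h1, h2]
  simp [mul_comm]

theorem norm_toLp_sq {X : Ω → ℝ} (hX : MemLp X 2 P) : ‖hX.toLp X‖ ^ 2 = ∫ ω, X ω ^ 2 ∂P := by
  rw [← real_inner_self_eq_norm_sq, L2.inner_def]
  refine integral_congr_ae ?_
  filter_upwards [hX.coeFn_toLp] with ω h1
  rw [h1]
  simp [sq]

theorem HasBoundedSecondMoments.exists_norm_toLp_le {X : ℝ → Ω → ℝ}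
    (h : HasBoundedSecondMoments P X) : ∃ C : ℝ, ∀ t, ‖(h.1 t).toLp (X t)‖ ≤ C := by
  obtain ⟨C, hC⟩ := h.2
  refine ⟨Real.sqrt C, fun t => Real.le_sqrt_of_sq_le ?_⟩
  rw [norm_toLp_sq]
  exact hC t

theorem correlation_eq_crossCorrelation {ι : Type*} {u : ι → ℝ → Ω → ℝ} (h : IsWSS P u)
    (i j : ι) (s t : ℝ) :
    correlation P (u i) (u j) s t = crossCorrelation P (u i) (u j) (s - t) := by
  obtain ⟨r, hr⟩ := h.correlation i j
  rw [crossCorrelation, hr, hr, sub_zero]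

namespace Params

variable {ι : Type*} [Fintype ι] {p : Params ι} {u : ι → ℝ → Ω → ℝ} {h v : ℝ → Ω → ℝ}

theorem hilbertAccel_toLp_ae (hu : ∀ i t, MemLp (u i t) 2 P) (hh : ∀ t, MemLp (h t) 2 P)
    (hv : ∀ t, MemLp (v t) 2 P) (t : ℝ) :
    p.hilbertAccel (E := Lp ℝ 2 P) (fun i t => (hu i t).toLp (u i t)) (fun t => (hh t).toLp (h t))
      (fun t => (hv t).toLp (v t)) t =ᵐ[P] p.accel u h v t := by
  have hs : ∀ s : Finset ι, ((∑ i ∈ s, p.β i • ((hu i (t - (p.σ + p.δ i))).toLp (u i _)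
      - (hv (t - p.σ)).toLp (v _)) : Lp ℝ 2 P) : Ω → ℝ) =ᵐ[P]
      fun ω => ∑ i ∈ s, p.β i * (u i (t - (p.σ + p.δ i)) ω - v (t - p.σ) ω) := by
    intro s
    classical
    induction s using Finset.induction_on with
    | empty =>
      simp only [Finset.sum_empty]
      exact Lp.coeFn_zero ℝ 2 P
    | insert i s hi ih =>
      simp only [Finset.sum_insert hi]
      filter_upwards [ih, Lp.coeFn_add (p.β i • ((hu i (t - (p.σ + p.δ i))).toLp (u i _)
        - (hv (t - p.σ)).toLp (v _))) (∑ i ∈ s, p.β i • ((hu i (t - (p.σ + p.δ i))).toLp (u i _)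
        - (hv (t - p.σ)).toLp (v _))), Lp.coeFn_smul (p.β i)
        ((hu i (t - (p.σ + p.δ i))).toLp (u i _) - (hv (t - p.σ)).toLp (v _)),
        Lp.coeFn_sub ((hu i (t - (p.σ + p.δ i))).toLp (u i _))
        ((hv (t - p.σ)).toLp (v _)), (hu i (t - (p.σ + p.δ i))).coeFn_toLp,
        (hv (t - p.σ)).coeFn_toLp] with ω e1 e2 e3 e4 e5 e6
      rw [e2, Pi.add_apply, e1, e3, Pi.smul_apply, e4, Pi.sub_apply, e5, e6, smul_eq_mul]
  have hα : ((p.α • (p.κ • (hh (t - p.σ)).toLp (h _) - (hv (t - p.σ)).toLp (v _)) : Lp ℝ 2 P)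
      : Ω → ℝ) =ᵐ[P] fun ω => p.α * (p.κ * h (t - p.σ) ω - v (t - p.σ) ω) := by
    rw [← MemLp.toLp_const_smul, ← MemLp.toLp_sub, ← MemLp.toLp_const_smul]
    exact MemLp.coeFn_toLp _
  unfold hilbertAccel
  filter_upwards [hs Finset.univ, hα, Lp.coeFn_add
    (p.α • (p.κ • (hh (t - p.σ)).toLp (h _) - (hv (t - p.σ)).toLp (v _)))
    (∑ i, p.β i • ((hu i (t - (p.σ + p.δ i))).toLp (u i _) - (hv (t - p.σ)).toLp (v _)))]
    with ω e1 e2 e3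
  rw [e3, Pi.add_apply, e1, e2, accel]

theorem IsSteadyStateResponse.isHilbertResponse (hr : p.IsSteadyStateResponse P u h v)
    (hu : ∀ i t, MemLp (u i t) 2 P) :
    p.IsHilbertResponse (fun i t => (hu i t).toLp (u i t))
      (fun t => (hr.bounded_headway.1 t).toLp (h t))
      (fun t => (hr.bounded_speed.1 t).toLp (v t)) where
  bounded_left := hr.bounded_headway.exists_norm_toLp_le
  bounded_right := hr.bounded_speed.exists_norm_toLp_le
  hasDerivAt_left t := by
    rw [← MemLp.toLp_sub]
    exact hr.headway_eq.hasDerivAt_toLp hr.bounded_headway.1 t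
  hasDerivAt_right t := by
    refine (hr.speed_eq.hasDerivAt_toLp hr.bounded_speed.1 t).congr_deriv ?_
    refine Lp.ext ((MemLp.coeFn_toLp _).trans ?_)
    exact (hilbertAccel_toLp_ae hu hr.bounded_headway.1 hr.bounded_speed.1 t).symm

end Params

end MeanSquare

/-! ### Gaussian Hilbert spaces -/

section Gaussian

variable {Ω : Type*} [MeasurableSpace Ω] {P : Measure Ω}

/-- An `L²` variable is a centered Gaussian variable. -/
def IsCenteredGaussian (x : Lp ℝ 2 P) : Prop :=
  P.map x = gaussianReal 0 (‖x‖ ^ 2).toNNReal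

theorem IsCenteredGaussian.integral_eq_zero {x : Lp ℝ 2 P} (hx : IsCenteredGaussian x) :
    ∫ ω, x ω ∂P = 0 := by
  have h := integral_map (μ := P) (Lp.aestronglyMeasurable x).aemeasurable (f := fun r : ℝ => r)
    (Continuous.aestronglyMeasurable (by fun_prop))
  rw [← h, hx]
  exact integral_id_gaussianReal

theorem IsCenteredGaussian.variance_eq {x : Lp ℝ 2 P} (hx : IsCenteredGaussian x) :
    variance x P = ‖x‖ ^ 2 := by
  rw [variance_of_integral_eq_zero (Lp.aestronglyMeasurable x).aemeasurable hx.integral_eq_zero,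
    ← real_inner_self_eq_norm_sq, L2.inner_def]
  simp [sq]

variable [IsProbabilityMeasure P]

/-- An `L²`-convergent sequence has an almost surely convergent subsequence; the integrands have
modulus one, so dominated convergence applies. -/
theorem tendsto_charFun_map_of_tendsto_Lp {x : ℕ → Lp ℝ 2 P} {y : Lp ℝ 2 P}
    (h : Tendsto x atTop (𝓝 y)) : ∃ ns : ℕ → ℕ, StrictMono ns ∧ ∀ t : ℝ,
      Tendsto (fun n => charFun (P.map (x (ns n))) t) atTop (𝓝 (charFun (P.map y) t)) := by
  obtain ⟨ns, hns, hae⟩ := (tendstoInMeasure_of_tendsto_Lp h).exists_seq_tendsto_ae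
  refine ⟨ns, hns, fun t => ?_⟩
  have e : ∀ z : Lp ℝ 2 P, charFun (P.map z) t = ∫ ω, Complex.exp (t * z ω * Complex.I) ∂P := by
    intro z
    rw [charFun_apply_real, integral_map (Lp.aestronglyMeasurable z).aemeasurable
      (Continuous.aestronglyMeasurable (by fun_prop))]
  have hm : ∀ z : Lp ℝ 2 P,
      AEStronglyMeasurable (fun ω => Complex.exp (t * z ω * Complex.I)) P := fun z =>
    (show Continuous fun r : ℝ => Complex.exp (t * r * Complex.I) by
      fun_prop).comp_aestronglyMeasurable (Lp.aestronglyMeasurable z)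
  simp only [e]
  refine tendsto_integral_of_dominated_convergence (fun _ => (1 : ℝ)) (fun n => hm _)
    (integrable_const _) (fun n => Eventually.of_forall fun ω => ?_) ?_
  · rw [← Complex.ofReal_mul, Complex.norm_exp_ofReal_mul_I]
  · filter_upwards [hae] with ω hω
    have hc : Continuous fun r : ℝ => Complex.exp (t * r * Complex.I) := by fun_prop
    exact (hc.tendsto _).comp hω

theorem isCenteredGaussian_iff (x : Lp ℝ 2 P) : IsCenteredGaussian x ↔
    ∀ t : ℝ, charFun (P.map x) t = Complex.exp (-((‖x‖ : ℂ) ^ 2 * t ^ 2 / 2)) := by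
  have e : ∀ t : ℝ, charFun (gaussianReal 0 (‖x‖ ^ 2).toNNReal) t
      = Complex.exp (-((‖x‖ : ℂ) ^ 2 * t ^ 2 / 2)) := by
    intro t
    rw [charFun_gaussianReal, Real.coe_toNNReal _ (sq_nonneg _)]
    simp
  constructor
  · intro h t
    rw [h, e]
  · intro h
    have : IsProbabilityMeasure (P.map x) :=
      Measure.isProbabilityMeasure_map (Lp.aestronglyMeasurable x).aemeasurable
    refine Measure.ext_of_charFun (funext fun t => ?_)
    rw [h, e]

/-- Being centered Gaussian is an identity between the characteristic function and the norm, and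
both pass to the limit along a subsequence. -/
theorem isCenteredGaussian_of_tendsto {x : ℕ → Lp ℝ 2 P} {y : Lp ℝ 2 P}
    (h : Tendsto x atTop (𝓝 y)) (hx : ∀ n, IsCenteredGaussian (x n)) : IsCenteredGaussian y := by
  obtain ⟨ns, hns, hlim⟩ := tendsto_charFun_map_of_tendsto_Lp h
  rw [isCenteredGaussian_iff]
  intro t
  refine tendsto_nhds_unique (hlim t) ?_
  simp only [fun n => (isCenteredGaussian_iff _).1 (hx n) t]
  have hc : Continuous fun z : Lp ℝ 2 P => Complex.exp (-((‖z‖ : ℂ) ^ 2 * t ^ 2 / 2)) := by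
    fun_prop
  exact (hc.tendsto y).comp (h.comp hns.tendsto_atTop)

theorem isCenteredGaussian_of_mem_span {T : Type*} {X : T → Ω → ℝ} (hX : IsGaussianProcess X P)
    (hX2 : ∀ q, MemLp (X q) 2 P) (h0 : ∀ q, ∫ ω, X q ω ∂P = 0) {x : Lp ℝ 2 P}
    (hx : x ∈ Submodule.span ℝ (Set.range fun q => (hX2 q).toLp (X q))) :
    IsCenteredGaussian x := by
  obtain ⟨c, rfl⟩ := Finsupp.mem_span_range_iff_exists_finsupp.1 hx
  set x : Lp ℝ 2 P := c.sum fun q r => r • (hX2 q).toLp (X q) with hxdef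
  have hae : x =ᵐ[P] fun ω => ∑ q ∈ c.support, c q • X q ω := by
    have h1 : ∀ᵐ ω ∂P, ∀ q ∈ c.support, (c q • (hX2 q).toLp (X q) : Lp ℝ 2 P) ω = c q • X q ω := by
      rw [Filter.eventually_all_finset]
      intro q _
      filter_upwards [Lp.coeFn_smul (c q) ((hX2 q).toLp (X q)), (hX2 q).coeFn_toLp] with ω e1 e2
      rw [e1, Pi.smul_apply, e2]
    filter_upwards [Lp.coeFn_finsetSum c.support fun q => c q • (hX2 q).toLp (X q), h1] with ω e1 e2
    rw [hxdef, Finsupp.sum, e1, Finset.sum_apply]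
    exact Finset.sum_congr rfl e2
  have hg : HasGaussianLaw x P :=
    ((hX.smul fun q => c q).hasGaussianLaw_fun_sum (I := c.support)).congr hae.symm
  have hmean : ∫ ω, x ω ∂P = 0 := by
    rw [integral_congr_ae hae, integral_finsetSum _ fun q _ =>
      (by exact ((hX2 q).integrable one_le_two).smul (c q))]
    refine Finset.sum_eq_zero fun q _ => ?_
    rw [integral_smul, h0, smul_zero]
  have hvar : variance x P = ‖x‖ ^ 2 := by
    rw [variance_of_integral_eq_zero (Lp.aestronglyMeasurable x).aemeasurable hmean]
    rw [← real_inner_self_eq_norm_sq, L2.inner_def]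
    simp [sq]
  rw [IsCenteredGaussian, hg.map_eq_gaussianReal, hmean, hvar]

theorem isCenteredGaussian_of_mem_closure {T : Type*} {X : T → Ω → ℝ}
    (hX : IsGaussianProcess X P) (hX2 : ∀ q, MemLp (X q) 2 P) (h0 : ∀ q, ∫ ω, X q ω ∂P = 0)
    {x : Lp ℝ 2 P} (hx : x ∈
      (Submodule.span ℝ (Set.range fun q => (hX2 q).toLp (X q))).topologicalClosure) :
    IsCenteredGaussian x := by
  rw [← SetLike.mem_coe, Submodule.topologicalClosure_coe, mem_closure_iff_seq_limit] at hx
  obtain ⟨s, hs, hlim⟩ := hx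
  exact isCenteredGaussian_of_tendsto hlim fun n => isCenteredGaussian_of_mem_span hX hX2 h0 (hs n)

/-- Orthogonal elements of a space of centered Gaussian variables are independent. -/
theorem indepFun_of_inner_eq_zero {G : Submodule ℝ (Lp ℝ 2 P)} (hG : ∀ z ∈ G, IsCenteredGaussian z)
    {x y : Lp ℝ 2 P} (hx : x ∈ G) (hy : y ∈ G) (h : inner ℝ x y = 0) : IndepFun x y P := by
  have hxm := (Lp.aestronglyMeasurable x).aemeasurable
  have hym := (Lp.aestronglyMeasurable y).aemeasurable
  have hg : HasGaussianLaw (fun ω => (x ω, y ω)) P := by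
    refine ⟨isGaussian_of_map_eq_gaussianReal fun L => ?_⟩
    -- Every linear functional of the pair is again an element of `G`, so the pair is jointly
    -- Gaussian and zero covariance suffices for independence.
    let z : Lp ℝ 2 P := L (1, 0) • x + L (0, 1) • y
    have hz := hG z (G.add_mem (G.smul_mem _ hx) (G.smul_mem _ hy))
    refine ⟨0, (‖z‖ ^ 2).toNNReal, ?_⟩
    rw [← hz, AEMeasurable.map_map_of_aemeasurable (by fun_prop) (hxm.prodMk hym)]
    refine Measure.map_congr ?_
    filter_upwards [Lp.coeFn_add (L (1, 0) • x) (L (0, 1) • y), Lp.coeFn_smul (L (1, 0)) x,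
      Lp.coeFn_smul (L (0, 1)) y] with ω e1 e2 e3
    rw [e1, Pi.add_apply, e2, e3, Pi.smul_apply, Pi.smul_apply, Function.comp_apply]
    have : (x ω, y ω) = x ω • ((1, 0) : ℝ × ℝ) + y ω • ((0, 1) : ℝ × ℝ) := by simp
    rw [this, map_add, map_smul, map_smul]
    simp [mul_comm]
  refine hg.indepFun_of_covariance_eq_zero ?_
  rw [covariance_eq_sub (Lp.memLp x) (Lp.memLp y), (hG x hx).integral_eq_zero, zero_mul, sub_zero,
    ← h, L2.inner_def]
  simp [mul_comm]

theorem integral_max_zero_gaussianReal (s : ℝ) (hs : 0 ≤ s) :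
    ∫ r, max r 0 ∂gaussianReal 0 (s ^ 2).toNNReal = s / Real.sqrt (2 * Real.pi) := by
  -- For `s = 0` the law is a Dirac mass without density, so it is treated apart.
  rcases hs.eq_or_lt with rfl | hpos
  · simp
  have hv : (s ^ 2).toNNReal ≠ 0 := by
    rw [Ne, Real.toNNReal_eq_zero, not_le]
    positivity
  rw [integral_gaussianReal_eq_integral_smul hv]
  have e : ∀ r : ℝ, gaussianPDFReal 0 (s ^ 2).toNNReal r • max r 0
      = Set.indicator (Set.Ioi 0) (fun r => (Real.sqrt (2 * Real.pi * s ^ 2))⁻¹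
        * (r * Real.exp (-(2 * s ^ 2)⁻¹ * r ^ 2))) r := by
    intro r
    rw [gaussianPDFReal, Real.coe_toNNReal _ (sq_nonneg s)]
    by_cases hr : r ∈ Set.Ioi (0 : ℝ)
    · rw [Set.indicator_of_mem hr, max_eq_left (le_of_lt hr), smul_eq_mul, sub_zero,
        mul_assoc, mul_comm r]
      congr 3
      field_simp
    · rw [Set.indicator_of_notMem hr, max_eq_right (not_lt.1 hr), smul_zero]
  simp only [e]
  rw [integral_indicator measurableSet_Ioi, integral_const_mul]
  have hI : ∫ r in Set.Ioi (0 : ℝ), r * Real.exp (-(2 * s ^ 2)⁻¹ * r ^ 2) = s ^ 2 := by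
    have h1 := integral_mul_cexp_neg_mul_sq (b := (((2 * s ^ 2)⁻¹ : ℝ) : ℂ))
      (by rw [Complex.ofReal_re]; positivity)
    have h2 : ((∫ r in Set.Ioi (0 : ℝ), r * Real.exp (-(2 * s ^ 2)⁻¹ * r ^ 2) : ℝ) : ℂ)
        = ((s ^ 2 : ℝ) : ℂ) := by
      rw [← integral_complex_ofReal]
      refine Eq.trans (integral_congr_ae (Eventually.of_forall fun r => ?_)) (h1.trans ?_)
      · push_cast; rfl
      · push_cast
        have : (s : ℂ) ≠ 0 := by exact_mod_cast hpos.ne'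
        field_simp
    exact_mod_cast h2
  rw [hI, Real.sqrt_mul (by positivity), Real.sqrt_sq hs]
  have : Real.sqrt (2 * Real.pi) ≠ 0 := by positivity
  field_simp

end Gaussian

/-! ### The expected energy -/

section Energy

variable {Ω : Type*} [MeasurableSpace Ω] {P : Measure Ω}

theorem integrable_mul_max {X Y : Ω → ℝ} (hX : MemLp X 2 P) (hY : MemLp Y 2 P) :
    Integrable (fun ω => X ω * max (Y ω) 0) P :=
  hX.integrable_mul (hY.sup (MemLp.zero' (p := 2)))

/-- This crude bound only has to be uniform in time: it supplies the integrability on the product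
space needed for Fubini. -/
theorem integral_norm_mul_max_le {X Y : Ω → ℝ} (hX : MemLp X 2 P) (hY : MemLp Y 2 P) :
    ∫ ω, ‖X ω * max (Y ω) 0‖ ∂P ≤ (∫ ω, X ω ^ 2 ∂P) + ∫ ω, Y ω ^ 2 ∂P := by
  rw [← integral_add hX.integrable_sq hY.integrable_sq]
  refine integral_mono (integrable_mul_max hX hY).norm
    (hX.integrable_sq.add hY.integrable_sq) fun ω => ?_
  simp only [norm_mul, Real.norm_eq_abs]
  have h1 : |max (Y ω) 0| ≤ |Y ω| := by
    rcases le_total (Y ω) 0 with h | h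
    · rw [max_eq_right h, abs_zero]; exact abs_nonneg _
    · rw [max_eq_left h]
  calc |X ω| * |max (Y ω) 0| ≤ |X ω| * |Y ω| := by gcongr
    _ ≤ |X ω| ^ 2 + |Y ω| ^ 2 := by
        nlinarith [sq_nonneg (|X ω| - |Y ω|), sq_nonneg (|X ω|), sq_nonneg (|Y ω|)]
    _ = X ω ^ 2 + Y ω ^ 2 := by rw [sq_abs, sq_abs]

variable [IsProbabilityMeasure P]

/-- The surrogate energy of processes with uniformly bounded second moments is well defined, and
its expectation can be computed under the time integral. -/
theorem surrogateEnergy_integrable {v a : ℝ → Ω → ℝ} (hv : Measurable (Function.uncurry v))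
    (ha : Measurable (Function.uncurry a)) (hv2 : ∀ t, MemLp (v t) 2 P)
    (ha2 : ∀ t, MemLp (a t) 2 P) {C D : ℝ} (hC : ∀ t, ∫ ω, v t ω ^ 2 ∂P ≤ C)
    (hD : ∀ t, ∫ ω, a t ω ^ 2 ∂P ≤ D) {t₀ tf : ℝ} (ht : t₀ ≤ tf) :
    (∀ᵐ ω ∂P, IntervalIntegrable (fun t => v t ω * max (a t ω) 0) volume t₀ tf) ∧
    Integrable (surrogateEnergy v a t₀ tf) P ∧
    ∫ ω, surrogateEnergy v a t₀ tf ω ∂P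
      = ∫ t in t₀..tf, ∫ ω, v t ω * max (a t ω) 0 ∂P := by
  have hm : Measurable (Function.uncurry fun (t : ℝ) (ω : Ω) => v t ω * max (a t ω) 0) :=
    hv.mul (ha.max measurable_const)
  have hint : Integrable (Function.uncurry fun (t : ℝ) (ω : Ω) => v t ω * max (a t ω) 0)
      ((volume.restrict (Set.Ioc t₀ tf)).prod P) := by
    rw [integrable_prod_iff hm.aestronglyMeasurable]
    refine ⟨Eventually.of_forall fun t => integrable_mul_max (hv2 t) (ha2 t), ?_⟩
    refine Integrable.of_bound (C := C + D)
      hm.norm.stronglyMeasurable.integral_prod_right.aestronglyMeasurable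
      (Eventually.of_forall fun t => ?_)
    rw [Real.norm_of_nonneg (integral_nonneg fun _ => norm_nonneg _)]
    exact (integral_norm_mul_max_le (hv2 t) (ha2 t)).trans (add_le_add (hC t) (hD t))
  refine ⟨?_, ?_, ?_⟩
  · filter_upwards [hint.prod_left_ae] with ω hω
    exact (intervalIntegrable_iff_integrableOn_Ioc_of_le ht).2 hω
  · have e : surrogateEnergy v a t₀ tf
        = fun ω => ∫ t in Set.Ioc t₀ tf, v t ω * max (a t ω) 0 :=
      funext fun _ => intervalIntegral.integral_of_le ht
    rw [e]
    exact hint.integral_prod_right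
  · simp only [surrogateEnergy, intervalIntegral.integral_of_le ht]
    exact (integral_integral_swap hint).symm

end Energy

end Truck

end

/-! ### Transfer to `L²(P)` and assembly of the theorem -/

theorem theorem3 {ι Ω : Type*} [Fintype ι] [MeasurableSpace Ω]
    (P : Measure Ω) [IsProbabilityMeasure P]
    -- the closed loop: nonnegative delays, plant stability
    (p : Truck.Params ι) (hσ : 0 ≤ p.σ) (hδ : ∀ i, 0 ≤ p.δ i) (hstable : p.PlantStable)
    -- the speed perturbations `u i` of the preceding vehicles, with spectral densities
    (u : ι → ℝ → Ω → ℝ) (hu : Truck.IsStationaryGaussianInput P u)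
    (hR : ∀ i j, Integrable (Truck.crossCorrelation P (u i) (u j)))
    -- the perturbations `h'`, `v'` of the truck's headway and speed
    (h' v' : ℝ → Ω → ℝ) (hresp : p.IsSteadyStateResponse P u h' v')
    -- the equilibrium speed, the truck's speed `v` and its acceleration `a`
    (vStar : ℝ) (v a : ℝ → Ω → ℝ) (hv : ∀ t ω, v t ω = vStar + v' t ω)
    (ha : Truck.IsMSDeriv P v a)
    (hv_meas : Measurable (Function.uncurry v)) (ha_meas : Measurable (Function.uncurry a))
    -- the time interval
    (t₀ tf : ℝ) (ht : t₀ ≤ tf) :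
    ∃ ϑ : ℝ, 0 ≤ ϑ ∧
      -- the spectral formula for `ϑ²`, all of whose integrals converge
      (∀ i j, IntegrableOn (p.accelSpectrum P u i j) (Set.Ioi 0)) ∧
      ((ϑ : ℂ) ^ 2 = 1 / Real.pi * ∑ i, ∑ j, ∫ w in Set.Ioi (0 : ℝ), p.accelSpectrum P u i j w) ∧
      -- `ϑ²` is the variance of the derivative of the speed and of the speed perturbation
      (∀ t, variance (a t) P = ϑ ^ 2) ∧
      (∀ t, variance (p.accel u h' v' t) P = ϑ ^ 2) ∧
      -- the energy is well defined and has the stated expectation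
      (∀ᵐ ω ∂P, IntervalIntegrable (fun t => v t ω * max (a t ω) 0) volume t₀ tf) ∧
      Integrable (Truck.surrogateEnergy v a t₀ tf) P ∧
      ∫ ω, Truck.surrogateEnergy v a t₀ tf ω ∂P
        = (tf - t₀) * (vStar / Real.sqrt (2 * Real.pi)) * ϑ := by
  have hu2 := hu.wss.memLp
  have hv'2 := hresp.bounded_speed.1
  set U : ι → ℝ → Lp ℝ 2 P := fun i t => (hu2 i t).toLp (u i t) with hU
  set X : ℝ → Lp ℝ 2 P := fun t => (hresp.bounded_headway.1 t).toLp (h' t) with hX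
  set Y : ℝ → Lp ℝ 2 P := fun t => (hv'2 t).toLp (v' t) with hY
  have hr : p.IsHilbertResponse U X Y := hresp.isHilbertResponse hu2
  set A : ℝ → Lp ℝ 2 P := p.hilbertAccel U X Y with hA
  have hUc : ∀ i, Continuous (U i) := fun i => continuous_iff_continuousAt.2 fun t =>
    let ⟨_, hd⟩ := hu.msDifferentiable i
    (hd.hasDerivAt_toLp (hu2 i) t).continuousAt
  have hUR : ∀ i j s t, inner ℝ (U i s) (U j t) = Truck.crossCorrelation P (u i) (u j) (s - t) :=
    fun i j s t => by
      rw [← Truck.correlation_eq_crossCorrelation hu.wss,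
        Truck.correlation_eq_inner (hu2 i) (hu2 j)]
  have hmain := fun t => hr.inner_hilbertAccel hstable hUc hUR hR t
  -- The spectral expression does not involve `t`, so `ϑ` can be taken to be `‖A 0‖`.
  have hnorm : ∀ t, ‖A t‖ = ‖A 0‖ := fun t => by
    have h1 := (hmain t).2.trans (hmain 0).2.symm
    rw [← Complex.ofReal_pow, ← Complex.ofReal_pow, Complex.ofReal_inj] at h1
    exact (sq_eq_sq₀ (norm_nonneg _) (norm_nonneg _)).1 h1
  have hgauss := fun z hz => Truck.isCenteredGaussian_of_mem_closure hu.gaussian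
    (fun q => hu2 q.1 q.2) (fun q => hu.mean_zero q.1 q.2) (x := z) hz
  have hAm := fun t => hr.hilbertAccel_mem_closure_span hstable t
  have hYm := fun t => (hr.mem_closure_span hstable t).2
  have hA_accel : ∀ t, A t =ᵐ[P] p.accel u h' v' t := fun t =>
    Truck.Params.hilbertAccel_toLp_ae hu2 hresp.bounded_headway.1 hv'2 t
  have ha' : Truck.IsMSDeriv P v' a := fun t => by
    refine ⟨(ha t).1, ?_⟩
    simpa only [hv, add_sub_add_left_eq_sub] using (ha t).2
  -- The given derivative `a` and the right-hand side of the speed equation agree almost surely at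
  -- each time, by uniqueness of derivatives in `L²`.
  have hA_a : ∀ t, A t =ᵐ[P] a t := fun t => by
    have : (ha' t).1.toLp (a t) = A t :=
      (ha'.hasDerivAt_toLp hv'2 t).unique (hr.hasDerivAt_right t)
    rw [← this]
    exact MemLp.coeFn_toLp _
  have hvarA : ∀ t, variance (A t) P = ‖A 0‖ ^ 2 := fun t => by
    rw [(hgauss _ (hAm t)).variance_eq, ← hA, hnorm]
  have ha2 : ∀ t, MemLp (a t) 2 P := fun t => (ha t).1
  have hv2 : ∀ t, MemLp (v t) 2 P := fun t => by
    rw [show v t = fun ω => vStar + v' t ω from funext (hv t)]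
    exact (memLp_const vStar).add (hv'2 t)
  have hYmean : ∀ t, ∫ ω, v' t ω ∂P = 0 := fun t => by
    rw [← integral_congr_ae (hv'2 t).coeFn_toLp]
    exact (hgauss _ (hYm t)).integral_eq_zero
  have hmax : ∀ t, ∫ ω, max (a t ω) 0 ∂P = ‖A 0‖ / Real.sqrt (2 * Real.pi) := fun t => by
    rw [← Truck.integral_max_zero_gaussianReal _ (norm_nonneg _), ← hnorm t,
      ← hgauss _ (hAm t), integral_map (Lp.aestronglyMeasurable _).aemeasurable
        (Continuous.aestronglyMeasurable (by fun_prop))]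
    refine integral_congr_ae ?_
    filter_upwards [hA_a t] with ω hω
    rw [← hω]
  have hmean : ∀ t, ∫ ω, v t ω * max (a t ω) 0 ∂P
      = vStar / Real.sqrt (2 * Real.pi) * ‖A 0‖ := fun t => by
    -- Orthogonality within the Gaussian space yields independence, which survives taking the
    -- positive part of `a`; hence the contribution of `v'` to the mean power vanishes.
    have hind : IndepFun (v' t) (fun ω => max (a t ω) 0) P := by
      have h1 := Truck.indepFun_of_inner_eq_zero hgauss (hYm t) (hAm t) (hmain t).1
      have h2 := h1.congr (hv'2 t).coeFn_toLp (hA_a t)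
      exact h2.comp measurable_id (measurable_id.max measurable_const)
    have hcross : ∫ ω, v' t ω * max (a t ω) 0 ∂P = 0 := by
      rw [hind.integral_fun_mul_eq_mul_integral (hv'2 t).1
        ((ha2 t).sup (MemLp.zero' (p := 2))).1, hYmean, zero_mul]
    have hmi : Integrable (fun ω => max (a t ω) 0) P :=
      ((ha2 t).sup (MemLp.zero' (p := 2))).integrable one_le_two
    simp only [hv, add_mul]
    rw [integral_add (hmi.const_mul _) (Truck.integrable_mul_max (hv'2 t) (ha2 t)), hcross,
      integral_const_mul, hmax]
    ring
  obtain ⟨C, hC⟩ := hresp.bounded_speed.2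
  have hvC : ∀ t, ∫ ω, v t ω ^ 2 ∂P ≤ vStar ^ 2 + C := fun t => by
    have hi := (hv'2 t).integrable one_le_two
    have : ∫ ω, v t ω ^ 2 ∂P = vStar ^ 2 + ∫ ω, v' t ω ^ 2 ∂P := by
      have e : (fun ω => v t ω ^ 2)
          = fun ω => (vStar ^ 2 + 2 * vStar * v' t ω) + v' t ω ^ 2 := by
        funext ω; rw [hv]; ring
      rw [e, integral_add (by exact (integrable_const _).add (hi.const_mul _))
          (hv'2 t).integrable_sq,
        integral_add (integrable_const _) (hi.const_mul _), integral_const_mul, hYmean]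
      simp
    rw [this]
    linarith [hC t]
  have haD : ∀ t, ∫ ω, a t ω ^ 2 ∂P ≤ ‖A 0‖ ^ 2 := fun t => by
    rw [← Truck.norm_toLp_sq (ha2 t), ← hnorm t]
    refine le_of_eq ?_
    congr 2
    exact Lp.ext ((MemLp.coeFn_toLp _).trans (hA_a t).symm)
  obtain ⟨hE1, hE2, hE3⟩ := Truck.surrogateEnergy_integrable hv_meas ha_meas hv2 ha2 hvC haD ht
  refine ⟨‖A 0‖, norm_nonneg _, fun i j => ?_, (hmain 0).2, fun t => ?_, fun t => ?_, hE1, hE2, ?_⟩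
  · exact (Truck.Params.integrable_accelDensity hstable
      (Truck.integrable_spectralDensity hUc hUR hR i j) i j).integrableOn
  · rw [← hvarA t]
    exact (variance_congr (hA_a t)).symm
  · rw [← hvarA t]
    exact (variance_congr (hA_accel t)).symm
  · rw [hE3]
    simp only [hmean, intervalIntegral.integral_const, smul_eq_mul]
    ring
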